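/- Let $\mathcal H$ be a complex Hilbert space and $m\ge 0$ an integer. *Measurements.* A measurement in $\mathcal H$ with outcomes in $\mathbb R^m$ is a countably additive (in the strong operator topology) map $M$ from the Borel sets of $\mathbb R^m$ to the nonnegative bounded operators on $\mathcal H$ with $M(\emptyset)=0$ and $M(\mathbb R^m)=I$; it is *simple* if every $M(B)$ is an orthogonal projection. For a real function $f$ that is square integrable with respect to $\langle\psi|M(dx)|\psi\rangle$, the vector $\int f(x)\,M(dx)\,\psi\in\mathcal H$ is defined by $L^2$-continuous extension from simple functions. *Models.* An $m$-parameter pure-state model is a family of unit vectors $\phi(\theta)\in\mathcal H$, $\theta\in\Theta$, with $\Theta\subset\mathbb R^m$ open and $\phi$ differentiable on $\Theta$; its states are $\rho(\theta)=|\phi(\theta)\rangle\langle\phi(\theta)|$. Let $l_j=2\bigl(\partial_j\phi-\langle\phi|\partial_j\phi\rangle\phi\bigr)$ be the horizontal lifts, i.e. $\partial_j\rho=\tfrac12(|l_j\rangle\langle\phi|+|\phi\rangle\langle l_j|)$ and $\langle l_j|\phi\rangle=0$. Write $E_\theta[M]^i=\int x_i\,\langle\phi(\theta)|M(dx)|\phi(\theta)\rangle$,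 and, if $M$ has finite second moments at $\theta$, $V_\theta[M]^{ij}=\int (x_i-\theta^i)(x_j-\theta^j)\,\langle\phi(\theta)|M(dx)|\phi(\theta)\rangle$. *Unbiasedness.* $M$ is unbiased if $E_\theta[M]=\theta$ for all $\theta\in\Theta$. At a point $\theta\in\Theta$, consider the conditions (D) $E_{\theta'}[M]$ exists for $\theta'$ in a neighbourhood of $\theta$, $E_\theta[M]=\theta$ and $\partial_jE_\theta[M]^i=\delta^i_j$ for $i,j=1,\dots,m$ (local unbiasedness; unbiased measurements satisfy it at every $\theta\in\Theta$); (E) the estimation vectors $x^i=\int (x_i-\theta^i)\,M(dx)\,\phi(\theta)$ satisfy $\langle\phi(\theta)|x^i\rangle=0$ and $\mathrm{Re}\,\langle l_j|x^i\rangle=\delta^i_j$ for $i,j=1,\dots,m$ (that is, (D) with the derivative taken under the integral sign). **Statement.** Suppose that $\dim\mathcal H\ge 2m+1$, or that $\mathcal H$ is infinite-dimensional. Let $\theta\in\Theta$ be a point of an $m$-parameter pure-state model in $\mathcal H$, and let $M$ be a measurement in $\mathcal H$ with outcomes in $\mathbb R^m$ and with finite second moments at $\theta$. Suppose that $M$ satisfies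 (E), or that $M$ satisfies (D) and, if $\mathcal H$ is infinite-dimensional, has second moments $\int|x|^2\langle\phi(\theta')|M(dx)|\phi(\theta')\rangle$ bounded uniformly for $\theta'$ in some neighbourhood of $\theta$. Then there is a simple measurement $E$ in $\mathcal H$ itself, with outcomes in $\mathbb R^m$ and with second moments bounded uniformly in a neighbourhood of $\theta$, that satisfies both (D) and (E) at $\theta$ and has $V_\theta[E]=V_\theta[M]$. -/

import Mathlib

open MeasureTheory Filter Topology
open scoped ENNReal NNReal InnerProductSpace

noncomputable section

/-- A (generalized) measurement in the Hilbert space `H` with outcomes in `ℝ^m`: a countably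
additive map from the Borel sets of `ℝ^m` to the nonnegative operators in `H`, with total mass the
identity.  Countable additivity is in the strong operator topology.  The values on sets that are
not Borel play no role. -/
structure Measurement (m : ℕ) (H : Type*) [NormedAddCommGroup H] [InnerProductSpace ℂ H]
    [CompleteSpace H] where
  op : Set (EuclideanSpace ℝ (Fin m)) → H →L[ℂ] H
  isPositive : ∀ B, MeasurableSet B → (op B).IsPositive
  op_empty : op ∅ = 0
  op_univ : op Set.univ = 1
  op_iUnion : ∀ B : ℕ → Set (EuclideanSpace ℝ (Fin m)), (∀ i, MeasurableSet (B i)) →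
    Pairwise (fun i j => Disjoint (B i) (B j)) →
    ∀ ψ : H, HasSum (fun i => op (B i) ψ) (op (⋃ i, B i) ψ)

/-- An `m`-parameter pure state model: a differentiable family of unit vectors `φ θ`, where `θ`
runs through an open set `Θ` of `ℝ^m`; the state with parameter `θ` is `|φ θ⟩⟨φ θ|`. -/
structure PureStateModel (m : ℕ) (H : Type*) [NormedAddCommGroup H] [InnerProductSpace ℂ H] where
  Θ : Set (EuclideanSpace ℝ (Fin m))
  isOpen_Θ : IsOpen Θ
  φ : EuclideanSpace ℝ (Fin m) → H
  norm_φ : ∀ θ ∈ Θ, ‖φ θ‖ = 1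
  differentiableAt_φ : ∀ θ ∈ Θ, DifferentiableAt ℝ φ θ

namespace PureStateModel

variable {m : ℕ} {H : Type*} [NormedAddCommGroup H] [InnerProductSpace ℂ H]

/-- The partial derivative `∂_j φ` at `θ`. -/
def partialDeriv (S : PureStateModel m H) (θ : EuclideanSpace ℝ (Fin m)) (j : Fin m) : H :=
  fderiv ℝ S.φ θ (EuclideanSpace.single j 1)

/-- The horizontal lift `l_j = 2 (∂_j φ - ⟨φ|∂_j φ⟩ φ)` of `∂/∂θ^j`; the two lemmas
below are its defining equations. -/
def lift (S : PureStateModel m H) (θ : EuclideanSpace ℝ (Fin m)) (j : Fin m) : H :=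
  (2 : ℂ) • (S.partialDeriv θ j - ⟪S.φ θ, S.partialDeriv θ j⟫_ℂ • S.φ θ)

theorem inner_lift (S : PureStateModel m H) {θ : EuclideanSpace ℝ (Fin m)} (hθ : θ ∈ S.Θ)
    (j : Fin m) : ⟪S.lift θ j, S.φ θ⟫_ℂ = 0 := by
  have h : ⟪S.φ θ, S.φ θ⟫_ℂ = 1 := by
    rw [inner_self_eq_norm_sq_to_K, S.norm_φ θ hθ]; simp
  rw [lift, inner_smul_left, inner_sub_left, inner_smul_left, inner_conj_symm, h]
  simp

theorem hasLineDerivAt_state (S : PureStateModel m H) {θ : EuclideanSpace ℝ (Fin m)}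
    (hθ : θ ∈ S.Θ) (j : Fin m) :
    HasLineDerivAt ℝ (fun θ' => InnerProductSpace.rankOne ℂ (S.φ θ') (S.φ θ'))
      ((1 / 2 : ℝ) • (InnerProductSpace.rankOne ℂ (S.lift θ j) (S.φ θ)
        + InnerProductSpace.rankOne ℂ (S.φ θ) (S.lift θ j)))
      θ (EuclideanSpace.single j 1) := by
  have hd : HasDerivAt (fun t : ℝ => S.φ (θ + t • EuclideanSpace.single j (1 : ℝ)))
      (S.partialDeriv θ j) 0 :=
    (S.differentiableAt_φ θ hθ).hasFDerivAt.hasLineDerivAt _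
  have hb : IsBoundedBilinearMap ℝ
      (fun p : H × H => InnerProductSpace.rankOne ℂ p.1 p.2) :=
    { add_left := fun x y z => by simp
      smul_left := fun c x y => by ext; simp
      add_right := fun x y z => by simp
      smul_right := fun c x y => by
        ext z
        rw [RCLike.real_smul_eq_coe_smul (K := ℂ) c y,
          RCLike.real_smul_eq_coe_smul (K := ℂ) c (InnerProductSpace.rankOne ℂ x y)]
        simp only [InnerProductSpace.rankOne_apply, inner_smul_left, smul_apply,
          RCLike.conj_ofReal, mul_smul]
      bound := ⟨1, one_pos, fun x y => by simp⟩ }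
  have h0 : S.φ (θ + (0 : ℝ) • EuclideanSpace.single j (1 : ℝ)) = S.φ θ := by simp
  have h1 := (hb.hasFDerivAt (S.φ (θ + (0 : ℝ) • EuclideanSpace.single j (1 : ℝ)),
    S.φ (θ + (0 : ℝ) • EuclideanSpace.single j (1 : ℝ)))).comp_hasDerivAt (0 : ℝ)
      (hd.prodMk hd)
  rw [h0] at h1
  have hc : ⟪S.φ θ, S.partialDeriv θ j⟫_ℂ + ⟪S.partialDeriv θ j, S.φ θ⟫_ℂ = 0 := by
    have h2 := hd.inner ℂ hd
    rw [h0] at h2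
    have hev : ∀ᶠ t : ℝ in 𝓝 0, θ + t • EuclideanSpace.single j (1 : ℝ) ∈ S.Θ := by
      have hcont : Continuous fun t : ℝ => θ + t • EuclideanSpace.single j (1 : ℝ) := by
        fun_prop
      exact hcont.continuousAt.eventually_mem (S.isOpen_Θ.mem_nhds (by simpa using hθ))
    have h3 : HasDerivAt (fun _ : ℝ => (1 : ℂ))
        (⟪S.φ θ, S.partialDeriv θ j⟫_ℂ + ⟪S.partialDeriv θ j, S.φ θ⟫_ℂ) 0 :=
      h2.congr_of_eventuallyEq (hev.mono fun t ht => by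
        simp [inner_self_eq_norm_sq_to_K, S.norm_φ _ ht])
    exact h3.unique (hasDerivAt_const _ _)
  refine h1.congr_deriv ?_
  ext z
  have hc' := eq_neg_of_add_eq_zero_left hc
  simp only [IsBoundedBilinearMap.deriv_apply, lift, inner_smul_left, inner_sub_left,
    inner_conj_symm, InnerProductSpace.rankOne_apply, add_apply, smul_apply, map_ofNat,
    RCLike.real_smul_eq_coe_smul (K := ℂ) (1 / 2 : ℝ)]
  rw [hc']
  simp only [RCLike.ofReal_div, RCLike.ofReal_one, RCLike.ofReal_ofNat]
  module

end PureStateModel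

namespace Measurement

variable {m : ℕ} {H : Type*} [NormedAddCommGroup H] [InnerProductSpace ℂ H] [CompleteSpace H]

/-- The distribution `B ↦ ⟨ψ|M(B)|ψ⟩ = tr |ψ⟩⟨ψ| M(B)` of the outcome when the state vector
is `ψ`. -/
def dist (M : Measurement m H) (ψ : H) : Measure (EuclideanSpace ℝ (Fin m)) :=
  Measure.ofMeasurable (fun B _ => ENNReal.ofReal (RCLike.re ⟪ψ, M.op B ψ⟫_ℂ))
    (by simp [M.op_empty])
    (by
      intro B hB hd
      have h1 : HasSum (fun i => RCLike.re ⟪ψ, M.op (B i) ψ⟫_ℂ)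
          (RCLike.re ⟪ψ, M.op (⋃ i, B i) ψ⟫_ℂ) :=
        RCLike.hasSum_re ℂ ((M.op_iUnion B hB hd ψ).mapL (innerSL ℂ ψ))
      rw [← h1.tsum_eq]
      exact ENNReal.ofReal_tsum_of_nonneg
        (fun i => (M.isPositive (B i) (hB i)).re_inner_nonneg_right ψ) h1.summable)

theorem dist_apply (M : Measurement m H) (ψ : H) {B : Set (EuclideanSpace ℝ (Fin m))}
    (hB : MeasurableSet B) :
    M.dist ψ B = ENNReal.ofReal (RCLike.re ⟪ψ, M.op B ψ⟫_ℂ) :=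
  Measure.ofMeasurable_apply B hB

/-- A simple measurement: all its values are orthogonal projections. -/
def IsSimple (M : Measurement m H) : Prop :=
  ∀ B, MeasurableSet B → IsStarProjection (M.op B)

/-- The vector `∫ s(x) M(dx) ψ` for a simple function `s`. -/
def simpleIntegral (M : Measurement m H) (s : SimpleFunc (EuclideanSpace ℝ (Fin m)) ℝ) (ψ : H) :
    H :=
  ∑ c ∈ s.range, (c : ℂ) • M.op (s ⁻¹' {c}) ψ

/-- `v = ∫ f(x) M(dx) ψ`, where `f` is square integrable with respect to `⟨ψ|M(dx)|ψ⟩`: the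
extension of the integral from simple functions by `L²` continuity. -/
def IsIntegral (M : Measurement m H) (f : EuclideanSpace ℝ (Fin m) → ℝ) (ψ v : H) : Prop :=
  MemLp f 2 (M.dist ψ) ∧
    ∀ s : ℕ → SimpleFunc (EuclideanSpace ℝ (Fin m)) ℝ,
      Tendsto (fun n => eLpNorm (fun x => s n x - f x) 2 (M.dist ψ)) atTop (𝓝 0) →
      Tendsto (fun n => M.simpleIntegral (s n) ψ) atTop (𝓝 v)

variable (M : Measurement m H) (S : PureStateModel m H) (θ : EuclideanSpace ℝ (Fin m))

/-- The expectation of the `i`-th coordinate of the estimate when the parameter is `θ`. -/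
def mean (i : Fin m) : ℝ := ∫ x, x i ∂(M.dist (S.φ θ))

/-- The covariance matrix `V_θ[M]`. -/
def cov : Matrix (Fin m) (Fin m) ℝ :=
  Matrix.of fun i j => ∫ x, (x i - θ i) * (x j - θ j) ∂(M.dist (S.φ θ))

/-- The estimate has finite second moments when the parameter is `θ`. -/
def HasFiniteSecondMoments : Prop := ∫⁻ x, ‖x‖ₑ ^ 2 ∂(M.dist (S.φ θ)) < ∞

/-- The second moments of the estimate are bounded when the parameter varies in some
neighbourhood of `θ`. -/
def HasLocallyBoundedSecondMoments : Prop :=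
  ∃ C : ℝ≥0, ∀ᶠ θ' in 𝓝 θ, ∫⁻ x, ‖x‖ₑ ^ 2 ∂(M.dist (S.φ θ')) ≤ C

/-- `M` is unbiased: `E_θ[M] = θ` for all `θ` in `Θ`. -/
def IsUnbiased : Prop :=
  ∀ θ ∈ S.Θ, ∀ i, Integrable (fun x => x i) (M.dist (S.φ θ)) ∧ M.mean S θ i = θ i

/-- `M` is locally unbiased at `θ`: `E_θ[M] = θ` and `∂_j E_θ[M]^i = δ^i_j` at this `θ`
(where the expectations exist in a neighbourhood of `θ`). -/
def IsLocallyUnbiasedAt : Prop :=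
  ∀ i, (∀ᶠ θ' in 𝓝 θ, Integrable (fun x => x i) (M.dist (S.φ θ'))) ∧
    M.mean S θ i = θ i ∧
    ∀ j, HasLineDerivAt ℝ (fun θ' => M.mean S θ' i) (if i = j then 1 else 0) θ
      (EuclideanSpace.single j 1)

/-- The local unbiasedness conditions in terms of the estimation vectors
`x^i = ∫ (x_i - θ_i) M(dx) φ`: `⟨φ|x^i⟩ = 0` and `Re ⟨l_j|x^i⟩ = δ^i_j`. -/
def HasLocallyUnbiasedEstimationVectors : Prop :=
  ∀ i, ∃ v : H, M.IsIntegral (fun x => x i - θ i) (S.φ θ) v ∧ ⟪S.φ θ, v⟫_ℂ = 0 ∧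
    ∀ j, RCLike.re ⟪S.lift θ j, v⟫_ℂ = if i = j then 1 else 0

variable {M S θ}

theorem IsUnbiased.isLocallyUnbiasedAt (h : M.IsUnbiased S) (hθ : θ ∈ S.Θ) :
    M.IsLocallyUnbiasedAt S θ := by
  have hev : ∀ᶠ θ' in 𝓝 θ, θ' ∈ S.Θ := S.isOpen_Θ.mem_nhds hθ
  refine fun i => ⟨hev.mono fun θ' h' => (h θ' h' i).1, (h θ hθ i).2, fun j => ?_⟩
  have h1 : HasLineDerivAt ℝ (fun θ' : EuclideanSpace ℝ (Fin m) => θ' i)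
      (if i = j then 1 else 0) θ (EuclideanSpace.single j 1) := by
    have := (EuclideanSpace.proj i : EuclideanSpace ℝ (Fin m) →L[ℝ] ℝ).hasFDerivAt.hasLineDerivAt
      (x := θ) (EuclideanSpace.single j (1 : ℝ))
    simpa [Pi.single_apply] using this
  exact h1.congr_of_eventuallyEq (hev.mono fun θ' h' => (h θ' h' i).2)

end Measurement

end

/-! Condition (E) involves only the inner products of the estimation vectors x^i with φ and the
lifts l_j. For a projective measurement the covariance is the Gram matrix ⟨x^i|x^j⟩. For a general M
positivity gives only Gram(x) ≤ V as complex Hermitian matrices (`IsIntegral.norm_sum_sq_le`). So it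
suffices to replace the x^i by vectors y^i with the same inner products with φ and l_j and with Gram
matrix exactly V, and then to realize the y^i by a projective measurement.

For the first task, project x^i to L = span(φ, l_j), of dimension at most m + 1. Projection can only
shrink the Gram matrix, so V - Gram(Px) is positive semidefinite. It is therefore the Gram matrix of
m vectors in an m-dimensional subspace of Lᗮ, for which (m + 1) + m dimensions leave room. Adding
these vectors to Px^i gives y^i (`exists_gram_eq`).

For the second, V is real and ⟨φ|y^i⟩ = 0, so φ and the y^i span a real Hilbert space. Take an
orthonormal basis b_k of it with every ⟨b_k|φ⟩ nonzero, measure in this basis and report θ^i +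
⟨b_k|y^i⟩/⟨b_k|φ⟩. The estimation vectors are then ∑ ⟨b_k|y^i⟩ b_k = y^i, and the covariance is
⟨y^i|y^j⟩ = V (`exists_isSimple_isIntegral`).

The passage between (D) and (E) rests on the mean being a quadratic form in the state vector: moving
φ to φ + δ changes it by 2 Re⟨δ|x^i⟩ plus the same form at δ. That remainder is o(t) along a
differentiable curve, in finite dimension because the form is bounded where it is defined, and in
general because of the uniform second moments (`IsIntegral.hasLineDerivAt_mean`). -/

noncomputable section

/-! ### Outcome distributions and integrals of simple functions -/

namespace Measurement

variable {m : ℕ} {H : Type*} [NormedAddCommGroup H] [InnerProductSpace ℂ H] [CompleteSpace H]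

theorem op_union (M : Measurement m H) {A B : Set (EuclideanSpace ℝ (Fin m))}
    (hA : MeasurableSet A) (hB : MeasurableSet B) (hAB : Disjoint A B) (ψ : H) :
    M.op (A ∪ B) ψ = M.op A ψ + M.op B ψ := by
  let F : ℕ → Set (EuclideanSpace ℝ (Fin m)) := fun n => if n = 0 then A else if n = 1 then B else ∅
  have hF : ∀ i, MeasurableSet (F i) := by
    intro i; simp only [F]; split_ifs <;> simp [hA, hB]
  have hd : Pairwise (fun i j => Disjoint (F i) (F j)) := by
    intro i j hij
    simp only [F]
    split_ifs <;> first | omega | simp [hAB.symm]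
  have hU : (⋃ i, F i) = A ∪ B := by
    ext x
    simp only [Set.mem_iUnion, Set.mem_union]
    constructor
    · rintro ⟨i, hi⟩
      simp only [F] at hi
      split_ifs at hi
      · exact Or.inl hi
      · exact Or.inr hi
      · exact hi.elim
    · rintro (h | h)
      · exact ⟨0, by simpa [F] using h⟩
      · exact ⟨1, by simpa [F] using h⟩
  have h1 := M.op_iUnion F hF hd ψ
  rw [hU] at h1
  have h2 : HasSum (fun i => M.op (F i) ψ) (∑ i ∈ Finset.range 2, M.op (F i) ψ) := by
    apply hasSum_sum_of_ne_finset_zero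
    intro b hb
    have hb' : 2 ≤ b := by simpa [Nat.succ_le_iff] using hb
    have h0 : b ≠ 0 := by omega
    have h1 : b ≠ 1 := by omega
    simp [F, h0, h1, M.op_empty]
  rw [h1.unique h2]
  simp [Finset.sum_range_succ, F]

theorem dist_univ (M : Measurement m H) (ψ : H) :
    M.dist ψ Set.univ = ENNReal.ofReal (‖ψ‖ ^ 2) := by
  rw [M.dist_apply ψ MeasurableSet.univ, M.op_univ]
  simp [inner_self_eq_norm_sq_to_K, ← Complex.ofReal_pow]

instance isFiniteMeasure_dist (M : Measurement m H) (ψ : H) : IsFiniteMeasure (M.dist ψ) :=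
  ⟨by rw [dist_univ]; exact ENNReal.ofReal_lt_top⟩

theorem dist_real (M : Measurement m H) (ψ : H) {B : Set (EuclideanSpace ℝ (Fin m))}
    (hB : MeasurableSet B) : (M.dist ψ).real B = RCLike.re ⟪ψ, M.op B ψ⟫_ℂ := by
  rw [measureReal_def, M.dist_apply ψ hB,
    ENNReal.toReal_ofReal ((M.isPositive B hB).re_inner_nonneg_right ψ)]

theorem dist_real_univ (M : Measurement m H) (ψ : H) : (M.dist ψ).real Set.univ = ‖ψ‖ ^ 2 := by
  rw [measureReal_def, dist_univ, ENNReal.toReal_ofReal (by positivity)]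

theorem re_inner_op_comm (M : Measurement m H) {B : Set (EuclideanSpace ℝ (Fin m))}
    (hB : MeasurableSet B) (a b : H) :
    RCLike.re ⟪a, M.op B b⟫_ℂ = RCLike.re ⟪b, M.op B a⟫_ℂ := by
  have h : ⟪M.op B b, a⟫_ℂ = ⟪b, M.op B a⟫_ℂ := (M.isPositive B hB).isSymmetric b a
  rw [← h, inner_re_symm]

theorem re_inner_op_add (M : Measurement m H) {B : Set (EuclideanSpace ℝ (Fin m))}
    (hB : MeasurableSet B) (a b : H) :
    RCLike.re ⟪a + b, M.op B (a + b)⟫_ℂ = RCLike.re ⟪a, M.op B a⟫_ℂ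
      + 2 * RCLike.re ⟪b, M.op B a⟫_ℂ + RCLike.re ⟪b, M.op B b⟫_ℂ := by
  have := M.re_inner_op_comm hB a b
  simp only [map_add, inner_add_left, inner_add_right]
  linarith

/-- Positivity of M(B) at the vector a - b. All later bounds on M come from this inequality. -/
theorem two_mul_re_inner_op_le (M : Measurement m H) {B : Set (EuclideanSpace ℝ (Fin m))}
    (hB : MeasurableSet B) (a b : H) :
    2 * RCLike.re ⟪a, M.op B b⟫_ℂ ≤ RCLike.re ⟪a, M.op B a⟫_ℂ + RCLike.re ⟪b, M.op B b⟫_ℂ := by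
  have h := (M.isPositive B hB).re_inner_nonneg_right (a + -b)
  have h1 := M.re_inner_op_add hB a (-b)
  have h2 := M.re_inner_op_comm hB a b
  simp only [map_neg, inner_neg_left, inner_neg_right, neg_neg] at h1
  linarith

theorem dist_smul (M : Measurement m H) (c : ℂ) (a : H) :
    M.dist (c • a) = ENNReal.ofReal (‖c‖ ^ 2) • M.dist a := by
  ext B hB
  rw [M.dist_apply _ hB, Measure.smul_apply, M.dist_apply _ hB, smul_eq_mul,
    ← ENNReal.ofReal_mul (by positivity)]
  congr 1
  rw [map_smul, inner_smul_left, inner_smul_right, ← mul_assoc, RCLike.conj_mul,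
    ← RCLike.ofReal_pow, RCLike.re_ofReal_mul]

/-- The distribution is quadratic in the state vector, not additive; this parallelogram-type bound
is the substitute through which integrability and moment bounds pass to sums and differences. -/
theorem dist_add_le (M : Measurement m H) (a b : H) :
    M.dist (a + b) ≤ (2 : ℝ≥0∞) • (M.dist a + M.dist b) := by
  rw [Measure.le_iff]
  intro B hB
  have ha := (M.isPositive B hB).re_inner_nonneg_right a
  have hb := (M.isPositive B hB).re_inner_nonneg_right b
  rw [Measure.smul_apply, Measure.add_apply, M.dist_apply _ hB, M.dist_apply _ hB,
    M.dist_apply _ hB, smul_eq_mul, ← ENNReal.ofReal_add ha hb,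
    ← ENNReal.ofReal_ofNat 2, ← ENNReal.ofReal_mul (by norm_num)]
  apply ENNReal.ofReal_le_ofReal
  have := M.re_inner_op_add hB a b
  have h2 := M.two_mul_re_inner_op_le hB b a
  linarith

theorem dist_sub_le (M : Measurement m H) (a b : H) :
    M.dist (a - b) ≤ (2 : ℝ≥0∞) • (M.dist a + M.dist b) := by
  have h := M.dist_add_le a (-b)
  have h2 := M.dist_smul (-1) b
  simp only [neg_smul, one_smul, norm_neg, norm_one, one_pow, ENNReal.ofReal_one] at h2
  rwa [h2, ← sub_eq_add_neg] at h

theorem integrable_dist_add (M : Measurement m H) {a b : H} {f : EuclideanSpace ℝ (Fin m) → ℝ}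
    (ha : Integrable f (M.dist a)) (hb : Integrable f (M.dist b)) :
    Integrable f (M.dist (a + b)) :=
  ((ha.add_measure hb).smul_measure (by simp)).mono_measure (M.dist_add_le a b)

theorem integrable_dist_smul (M : Measurement m H) (c : ℂ) {a : H}
    {f : EuclideanSpace ℝ (Fin m) → ℝ} (ha : Integrable f (M.dist a)) :
    Integrable f (M.dist (c • a)) := by
  rw [dist_smul]
  exact ha.smul_measure (by simp)

theorem integrable_dist_sub (M : Measurement m H) {a b : H} {f : EuclideanSpace ℝ (Fin m) → ℝ}
    (ha : Integrable f (M.dist a)) (hb : Integrable f (M.dist b)) :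
    Integrable f (M.dist (a - b)) :=
  ((ha.add_measure hb).smul_measure (by simp)).mono_measure (M.dist_sub_le a b)

theorem integral_dist_smul (M : Measurement m H) (c : ℂ) (a : H)
    (f : EuclideanSpace ℝ (Fin m) → ℝ) :
    ∫ x, f x ∂(M.dist (c • a)) = ‖c‖ ^ 2 * ∫ x, f x ∂(M.dist a) := by
  rw [dist_smul, integral_smul_measure, ENNReal.toReal_ofReal (by positivity), smul_eq_mul]

theorem integral_le_of_le_two_smul_add {μ ν ρ : Measure (EuclideanSpace ℝ (Fin m))}
    {f : EuclideanSpace ℝ (Fin m) → ℝ} (hle : μ ≤ (2 : ℝ≥0∞) • (ν + ρ)) (hf : 0 ≤ f)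
    (ha : Integrable f ν) (hb : Integrable f ρ) :
    ∫ x, f x ∂μ ≤ 2 * (∫ x, f x ∂ν + ∫ x, f x ∂ρ) := by
  refine (integral_mono_measure hle (Eventually.of_forall hf)
    ((ha.add_measure hb).smul_measure (by simp))).trans_eq ?_
  rw [integral_smul_measure, integral_add_measure ha hb]
  simp

theorem integral_simpleFunc_dist (M : Measurement m H)
    (s : SimpleFunc (EuclideanSpace ℝ (Fin m)) ℝ) (ψ : H) :
    ∫ x, s x ∂(M.dist ψ) = ∑ c ∈ s.range, c * RCLike.re ⟪ψ, M.op (s ⁻¹' {c}) ψ⟫_ℂ := by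
  rw [← SimpleFunc.integral_eq_integral s (SimpleFunc.integrable_of_isFiniteMeasure s),
    SimpleFunc.integral_eq]
  refine Finset.sum_congr rfl fun c _ => ?_
  rw [M.dist_real ψ (s.measurableSet_preimage _), smul_eq_mul, mul_comm]

theorem inner_simpleIntegral_self (M : Measurement m H)
    (s : SimpleFunc (EuclideanSpace ℝ (Fin m)) ℝ) (ψ : H) :
    ⟪ψ, M.simpleIntegral s ψ⟫_ℂ = ((∫ x, s x ∂(M.dist ψ) : ℝ) : ℂ) := by
  rw [integral_simpleFunc_dist, simpleIntegral, inner_sum, Complex.ofReal_sum]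
  refine Finset.sum_congr rfl fun c _ => ?_
  rw [inner_smul_right, Complex.ofReal_mul]
  congr 1
  have h := RCLike.nonneg_iff.mp
    ((M.isPositive _ (s.measurableSet_preimage {c})).inner_nonneg_right ψ)
  exact Complex.ext rfl h.2

/-- Polarization: the cross term is an inner product with the integral vector, which is how
estimation vectors come to govern the derivative of the mean. -/
theorem integral_simpleFunc_dist_add (M : Measurement m H)
    (s : SimpleFunc (EuclideanSpace ℝ (Fin m)) ℝ) (a b : H) :
    ∫ x, s x ∂(M.dist (a + b)) = ∫ x, s x ∂(M.dist a)
      + 2 * RCLike.re ⟪b, M.simpleIntegral s a⟫_ℂ + ∫ x, s x ∂(M.dist b) := by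
  simp only [integral_simpleFunc_dist, simpleIntegral, inner_sum, map_sum, Finset.mul_sum,
    ← Finset.sum_add_distrib]
  refine Finset.sum_congr rfl fun c _ => ?_
  rw [M.re_inner_op_add (s.measurableSet_preimage _), inner_smul_right]
  have : RCLike.re ((c : ℂ) * ⟪b, M.op (s ⁻¹' {c}) a⟫_ℂ)
      = c * RCLike.re ⟪b, M.op (s ⁻¹' {c}) a⟫_ℂ := RCLike.re_ofReal_mul c _
  rw [this]
  ring

/-- The map `c ↦ c • M(B) ψ`. -/
def smulOp (M : Measurement m H) (ψ : H) (B : Set (EuclideanSpace ℝ (Fin m))) : ℂ →L[ℝ] H :=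
  (ContinuousLinearMap.toSpanSingleton ℂ (M.op B ψ)).restrictScalars ℝ

theorem smulOp_apply (M : Measurement m H) (ψ : H) (B : Set (EuclideanSpace ℝ (Fin m))) (c : ℂ) :
    M.smulOp ψ B c = c • M.op B ψ := rfl

theorem finMeasAdditive_smulOp (M : Measurement m H) (ψ : H)
    (μ : Measure (EuclideanSpace ℝ (Fin m))) : FinMeasAdditive μ (M.smulOp ψ) := by
  intro A B hA hB _ _ hAB
  ext
  simp [smulOp_apply, M.op_union hA hB hAB]

/-- The vector `∫ s(x) M(dx) ψ` for a complex-valued simple function `s`. -/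
def complexSimpleIntegral (M : Measurement m H) (s : SimpleFunc (EuclideanSpace ℝ (Fin m)) ℂ)
    (ψ : H) : H :=
  s.setToSimpleFunc (M.smulOp ψ)

theorem complexSimpleIntegral_add (M : Measurement m H)
    (s t : SimpleFunc (EuclideanSpace ℝ (Fin m)) ℂ) (ψ : H) :
    M.complexSimpleIntegral (s + t) ψ
      = M.complexSimpleIntegral s ψ + M.complexSimpleIntegral t ψ :=
  SimpleFunc.setToSimpleFunc_add _ (M.finMeasAdditive_smulOp ψ (M.dist ψ))
    (SimpleFunc.integrable_of_isFiniteMeasure s) (SimpleFunc.integrable_of_isFiniteMeasure t)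

theorem complexSimpleIntegral_smul (M : Measurement m H) (c : ℂ)
    (s : SimpleFunc (EuclideanSpace ℝ (Fin m)) ℂ) (ψ : H) :
    M.complexSimpleIntegral (c • s) ψ = c • M.complexSimpleIntegral s ψ :=
  SimpleFunc.setToSimpleFunc_smul _ (M.finMeasAdditive_smulOp ψ (M.dist ψ))
    (fun c B x => by simp [smulOp_apply, mul_smul]) c
    (SimpleFunc.integrable_of_isFiniteMeasure s)

theorem complexSimpleIntegral_sum (M : Measurement m H) {ι : Type*} (t : Finset ι)
    (s : ι → SimpleFunc (EuclideanSpace ℝ (Fin m)) ℂ) (ψ : H) :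
    M.complexSimpleIntegral (∑ i ∈ t, s i) ψ = ∑ i ∈ t, M.complexSimpleIntegral (s i) ψ := by
  classical
  induction t using Finset.induction_on with
  | empty =>
    have := M.complexSimpleIntegral_smul 0 0 ψ
    simpa using this
  | insert a t ha ih => rw [Finset.sum_insert ha, Finset.sum_insert ha,
      complexSimpleIntegral_add, ih]

theorem complexSimpleIntegral_ofReal (M : Measurement m H)
    (s : SimpleFunc (EuclideanSpace ℝ (Fin m)) ℝ) (ψ : H) :
    M.complexSimpleIntegral (s.map Complex.ofReal) ψ = M.simpleIntegral s ψ :=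
  SimpleFunc.map_setToSimpleFunc _ (M.finMeasAdditive_smulOp ψ (M.dist ψ))
    (SimpleFunc.integrable_of_isFiniteMeasure s) Complex.ofReal_zero

/-- With I the integral vector, apply 2 Re⟨a|M(B)|b⟩ ≤ ⟨a|M(B)|a⟩ + ⟨b|M(B)|b⟩ to a = I, b = cψ on
each level set of s and sum: 2‖I‖² ≤ ‖I‖² + ∫ |s|². This avoids a Naimark dilation. Complex values
are allowed because the Gram matrix must be compared with V as a complex Hermitian form. -/
theorem norm_complexSimpleIntegral_sq_le (M : Measurement m H)
    (s : SimpleFunc (EuclideanSpace ℝ (Fin m)) ℂ) (ψ : H) :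
    ‖M.complexSimpleIntegral s ψ‖ ^ 2 ≤ ∫ x, ‖s x‖ ^ 2 ∂(M.dist ψ) := by
  set I := M.complexSimpleIntegral s ψ with hI
  have h1 : ‖I‖ ^ 2 = ∑ c ∈ s.range, RCLike.re ⟪I, M.op (s ⁻¹' {c}) (c • ψ)⟫_ℂ := by
    have h : ‖I‖ ^ 2 = RCLike.re ⟪I, M.complexSimpleIntegral s ψ⟫_ℂ :=
      (inner_self_eq_norm_sq (𝕜 := ℂ) I).symm
    rw [h, complexSimpleIntegral, SimpleFunc.setToSimpleFunc, inner_sum, map_sum]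
    simp only [smulOp_apply, map_smul]
  have h2 : ∑ c ∈ s.range, RCLike.re ⟪I, M.op (s ⁻¹' {c}) I⟫_ℂ = ‖I‖ ^ 2 := by
    rw [← M.dist_real_univ I, measureReal_def, ← s.sum_range_measure_preimage_singleton,
      ENNReal.toReal_sum (fun _ _ => measure_ne_top _ _)]
    exact Finset.sum_congr rfl fun c _ => (M.dist_real I (s.measurableSet_preimage _)).symm
  have h3 : ∑ c ∈ s.range, RCLike.re ⟪c • ψ, M.op (s ⁻¹' {c}) (c • ψ)⟫_ℂ
      = ∫ x, ‖s x‖ ^ 2 ∂(M.dist ψ) := by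
    have h := SimpleFunc.map_integral (μ := M.dist ψ) s (fun c : ℂ => ‖c‖ ^ 2)
      (SimpleFunc.integrable_of_isFiniteMeasure s) (by simp)
    rw [SimpleFunc.integral_eq_integral _ (SimpleFunc.integrable_of_isFiniteMeasure _)] at h
    refine Eq.trans ?_ h.symm
    refine Finset.sum_congr rfl fun c _ => ?_
    rw [← M.dist_real _ (s.measurableSet_preimage _), measureReal_def, dist_smul]
    simp [measureReal_def, mul_comm]
  have h4 : ∑ c ∈ s.range, 2 * RCLike.re ⟪I, M.op (s ⁻¹' {c}) (c • ψ)⟫_ℂ ≤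
      ∑ c ∈ s.range, (RCLike.re ⟪I, M.op (s ⁻¹' {c}) I⟫_ℂ +
        RCLike.re ⟪c • ψ, M.op (s ⁻¹' {c}) (c • ψ)⟫_ℂ) :=
    Finset.sum_le_sum fun c _ => M.two_mul_re_inner_op_le (s.measurableSet_preimage _) _ _
  rw [← Finset.mul_sum, ← h1, Finset.sum_add_distrib, h2, h3] at h4
  linarith

theorem norm_simpleIntegral_sub_sq_le (M : Measurement m H)
    (s t : SimpleFunc (EuclideanSpace ℝ (Fin m)) ℝ) (ψ : H) :
    ‖M.simpleIntegral s ψ - M.simpleIntegral t ψ‖ ^ 2 ≤ ∫ x, (s x - t x) ^ 2 ∂(M.dist ψ) := by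
  have h := M.norm_complexSimpleIntegral_sq_le
    (s.map Complex.ofReal + (-1 : ℂ) • t.map Complex.ofReal) ψ
  rw [complexSimpleIntegral_add, complexSimpleIntegral_smul, complexSimpleIntegral_ofReal,
    complexSimpleIntegral_ofReal, neg_one_smul, ← sub_eq_add_neg] at h
  refine h.trans_eq (integral_congr_ae (Eventually.of_forall fun x => ?_))
  have : (s.map Complex.ofReal + (-1 : ℂ) • t.map Complex.ofReal) x = ((s x - t x : ℝ) : ℂ) := by
    simp [sub_eq_add_neg]
  simp only [this, Complex.norm_real, Real.norm_eq_abs, sq_abs]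

end Measurement

/-! ### Integrals of square integrable functions -/

/-- One sequence, chosen before the measure, is needed: polarization is passed to the limit for the
distributions of ψ, δ and ψ + δ simultaneously. -/
theorem exists_simpleFunc_approx {α : Type*} [MeasurableSpace α] {f : α → ℝ}
    (hf : Measurable f) :
    ∃ s : ℕ → SimpleFunc α ℝ, (∀ x, Tendsto (fun n => s n x) atTop (𝓝 (f x))) ∧
      (∀ n x, |s n x| ≤ 2 * |f x|) ∧
      ∀ μ : Measure α, MemLp f 2 μ →
        Tendsto (fun n => eLpNorm (fun x => s n x - f x) 2 μ) atTop (𝓝 0) := by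
  refine ⟨fun n => SimpleFunc.approxOn f hf Set.univ 0 (Set.mem_univ _) n, fun x => ?_,
    fun n x => ?_, fun μ hμ => ?_⟩
  · exact SimpleFunc.tendsto_approxOn hf _ (by simp)
  · have := SimpleFunc.norm_approxOn_zero_le hf (Set.mem_univ (0 : ℝ)) x n
    simp only [Real.norm_eq_abs] at this
    linarith
  · exact SimpleFunc.tendsto_approxOn_Lp_eLpNorm hf (Set.mem_univ (0 : ℝ)) (by simp)
      (Eventually.of_forall fun x => by simp) (by simpa using hμ.2)

theorem simpleFunc_sum_apply {α ι E : Type*} [MeasurableSpace α] [AddCommMonoid E] (t : Finset ι)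
    (s : ι → SimpleFunc α E) (x : α) : (∑ i ∈ t, s i) x = ∑ i ∈ t, s i x := by
  classical
  induction t using Finset.induction_on with
  | empty => rfl
  | insert a t ha ih => rw [Finset.sum_insert ha, Finset.sum_insert ha, ← ih]; rfl

theorem tendsto_integral_of_approx {α : Type*} [MeasurableSpace α] {μ : Measure α} {f : α → ℝ}
    (hf : Integrable f μ) {s : ℕ → SimpleFunc α ℝ}
    (hs : ∀ x, Tendsto (fun n => s n x) atTop (𝓝 (f x))) (hb : ∀ n x, |s n x| ≤ 2 * |f x|) :
    Tendsto (fun n => ∫ x, s n x ∂μ) atTop (𝓝 (∫ x, f x ∂μ)) :=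
  tendsto_integral_of_dominated_convergence (fun x => 2 * |f x|)
    (fun n => (s n).aestronglyMeasurable) (hf.abs.const_mul 2)
    (fun n => Eventually.of_forall fun x => by simpa using hb n x)
    (Eventually.of_forall hs)

namespace Measurement

variable {m : ℕ} {H : Type*} [NormedAddCommGroup H] [InnerProductSpace ℂ H] [CompleteSpace H]

theorem enorm_simpleIntegral_sub_le (M : Measurement m H)
    (s t : SimpleFunc (EuclideanSpace ℝ (Fin m)) ℝ) (ψ : H) :
    ‖M.simpleIntegral s ψ - M.simpleIntegral t ψ‖ₑ
      ≤ eLpNorm (fun x => s x - t x) 2 (M.dist ψ) := by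
  have hmem : MemLp (fun x => s x - t x) 2 (M.dist ψ) :=
    SimpleFunc.memLp_of_isFiniteMeasure (s - t) 2 _
  rw [hmem.eLpNorm_eq_integral_rpow_norm (by simp) (by simp), ← ofReal_norm]
  apply ENNReal.ofReal_le_ofReal
  have h := Real.sqrt_le_sqrt (M.norm_simpleIntegral_sub_sq_le s t ψ)
  rw [Real.sqrt_sq (norm_nonneg _), Real.sqrt_eq_rpow] at h
  simpa using h

theorem enorm_simpleIntegral_sub_le_add (M : Measurement m H) {ψ : H}
    {f : EuclideanSpace ℝ (Fin m) → ℝ} (hf : MemLp f 2 (M.dist ψ))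
    (s t : SimpleFunc (EuclideanSpace ℝ (Fin m)) ℝ) :
    ‖M.simpleIntegral s ψ - M.simpleIntegral t ψ‖ₑ
      ≤ eLpNorm (fun x => s x - f x) 2 (M.dist ψ)
        + eLpNorm (fun x => t x - f x) 2 (M.dist ψ) := by
  refine (M.enorm_simpleIntegral_sub_le s t ψ).trans ?_
  have : (fun x => s x - t x) = (fun x => s x - f x) - (fun x => t x - f x) := by
    ext x; simp
  rw [this]
  exact eLpNorm_sub_le (s.aestronglyMeasurable.sub hf.1) (t.aestronglyMeasurable.sub hf.1)
    (by norm_num)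

theorem exists_isIntegral (M : Measurement m H) {ψ : H} {f : EuclideanSpace ℝ (Fin m) → ℝ}
    (hm : Measurable f) (hf : MemLp f 2 (M.dist ψ)) : ∃ v, M.IsIntegral f ψ v := by
  obtain ⟨s, -, -, hs⟩ := exists_simpleFunc_approx hm
  have hs := hs _ hf
  have hc : CauchySeq (fun n => M.simpleIntegral (s n) ψ) := by
    rw [EMetric.cauchySeq_iff]
    intro ε hε
    have hε2 : 0 < ε / 2 := ENNReal.half_pos hε.ne'
    obtain ⟨N, hN⟩ := eventually_atTop.mp (hs.eventually (gt_mem_nhds hε2))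
    refine ⟨N, fun a ha b hb => ?_⟩
    rw [edist_eq_enorm_sub]
    refine (M.enorm_simpleIntegral_sub_le_add hf (s a) (s b)).trans_lt ?_
    exact (ENNReal.add_lt_add (hN a ha) (hN b hb)).trans_eq (ENNReal.add_halves ε)
  obtain ⟨v, hv⟩ := cauchySeq_tendsto_of_complete hc
  refine ⟨v, hf, fun t ht => ?_⟩
  have h0 : Tendsto (fun n => ‖M.simpleIntegral (t n) ψ - M.simpleIntegral (s n) ψ‖ₑ) atTop
      (𝓝 0) := by
    refine tendsto_of_tendsto_of_tendsto_of_le_of_le tendsto_const_nhds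
      (by simpa using ht.add hs) (fun _ => zero_le)
      (fun n => M.enorm_simpleIntegral_sub_le_add hf (t n) (s n))
  have h1 : Tendsto (fun n => M.simpleIntegral (t n) ψ - M.simpleIntegral (s n) ψ) atTop (𝓝 0) :=
    tendsto_zero_iff_enorm_tendsto_zero.mpr h0
  simpa using h1.add hv

namespace IsIntegral

variable {M : Measurement m H} {f : EuclideanSpace ℝ (Fin m) → ℝ} {ψ v : H}

theorem inner_self (h : M.IsIntegral f ψ v) (hm : Measurable f) :
    ⟪ψ, v⟫_ℂ = ((∫ x, f x ∂(M.dist ψ) : ℝ) : ℂ) := by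
  obtain ⟨s, hs, hb, hL⟩ := exists_simpleFunc_approx hm
  have h1 := tendsto_const_nhds (x := ψ).inner (𝕜 := ℂ) (h.2 s (hL _ h.1))
  simp only [inner_simpleIntegral_self] at h1
  refine tendsto_nhds_unique h1 ?_
  exact (Complex.continuous_ofReal.tendsto _).comp
    (tendsto_integral_of_approx (h.1.integrable (by norm_num)) hs hb)

/-- Limit of the polarization identity. Square integrability is needed only at ψ, where the vector v
lives; at δ plain integrability suffices for dominated convergence. -/
theorem integral_dist_add (h : M.IsIntegral f ψ v) (hm : Measurable f) {δ : H}
    (hδ : Integrable f (M.dist δ)) :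
    ∫ x, f x ∂(M.dist (ψ + δ)) = ∫ x, f x ∂(M.dist ψ) + 2 * RCLike.re ⟪δ, v⟫_ℂ
      + ∫ x, f x ∂(M.dist δ) := by
  obtain ⟨s, hs, hb, hL⟩ := exists_simpleFunc_approx hm
  have hi : Integrable f (M.dist ψ) := h.1.integrable (by norm_num)
  have h1 := tendsto_const_nhds (x := δ).inner (𝕜 := ℂ) (h.2 s (hL _ h.1))
  have h2 := ((RCLike.continuous_re (K := ℂ)).tendsto _).comp h1
  have h3 := ((tendsto_integral_of_approx hi hs hb).add (h2.const_mul 2)).add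
    (tendsto_integral_of_approx hδ hs hb)
  refine tendsto_nhds_unique (tendsto_integral_of_approx (M.integrable_dist_add hi hδ) hs hb) ?_
  refine h3.congr fun n => ?_
  rw [integral_simpleFunc_dist_add]
  rfl

/-- This is the matrix inequality Gram(v) ≤ (∫ f_i f_j), tested on an arbitrary complex vector c. -/
theorem norm_sum_sq_le {ι : Type*} [Fintype ι] {f : ι → EuclideanSpace ℝ (Fin m) → ℝ} {v : ι → H}
    (h : ∀ i, M.IsIntegral (f i) ψ (v i)) (hm : ∀ i, Measurable (f i)) (c : ι → ℂ) :
    ‖∑ i, c i • v i‖ ^ 2 ≤ ∫ x, ‖∑ i, c i * f i x‖ ^ 2 ∂(M.dist ψ) := by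
  choose s hs hb hL using fun i => exists_simpleFunc_approx (hm i)
  let t : ℕ → SimpleFunc (EuclideanSpace ℝ (Fin m)) ℂ :=
    fun n => ∑ i, c i • (s i n).map Complex.ofReal
  have ht : ∀ n x, t n x = ∑ i, c i * (s i n x : ℂ) := fun n x => by
    simp [t, simpleFunc_sum_apply]
  have h1 : Tendsto (fun n => ‖M.complexSimpleIntegral (t n) ψ‖ ^ 2) atTop
      (𝓝 (‖∑ i, c i • v i‖ ^ 2)) := by
    refine ((tendsto_finsetSum Finset.univ fun i _ =>
      ((h i).2 (s i) (hL i _ (h i).1)).const_smul (c i)).norm.pow 2).congr fun n => ?_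
    simp only [t, complexSimpleIntegral_sum, complexSimpleIntegral_smul,
      complexSimpleIntegral_ofReal]
  have h2 : Tendsto (fun n => ∫ x, ‖t n x‖ ^ 2 ∂(M.dist ψ)) atTop
      (𝓝 (∫ x, ‖∑ i, c i * f i x‖ ^ 2 ∂(M.dist ψ))) := by
    have hg : MemLp (fun x => ∑ i, ‖c i‖ * (2 * |f i x|)) 2 (M.dist ψ) :=
      memLp_finsetSum _ fun i _ => (((h i).1.abs).const_mul 2).const_mul _
    refine tendsto_integral_of_dominated_convergence
      (fun x => (∑ i, ‖c i‖ * (2 * |f i x|)) ^ 2)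
      (fun n => ((t n).aestronglyMeasurable.norm.pow 2)) hg.integrable_sq
      (fun n => Eventually.of_forall fun x => ?_) (Eventually.of_forall fun x => ?_)
    · rw [ht, Real.norm_eq_abs, abs_of_nonneg (by positivity)]
      refine pow_le_pow_left₀ (norm_nonneg _) ((norm_sum_le _ _).trans ?_) 2
      refine Finset.sum_le_sum fun i _ => ?_
      rw [norm_mul, Complex.norm_real]
      exact mul_le_mul_of_nonneg_left (hb i n x) (norm_nonneg _)
    · simp only [ht]
      exact (tendsto_finsetSum Finset.univ fun i _ =>
        (((Complex.continuous_ofReal.tendsto _).comp (hs i x)).const_mul (c i))).norm.pow 2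
  exact le_of_tendsto_of_tendsto' h1 h2 fun n => M.norm_complexSimpleIntegral_sq_le (t n) ψ

end IsIntegral

end Measurement

/-! ### Differentiating the mean under the integral sign -/

theorem PureStateModel.re_inner_lift {m : ℕ} {H : Type*} [NormedAddCommGroup H]
    [InnerProductSpace ℂ H] {S : PureStateModel m H} {θ : EuclideanSpace ℝ (Fin m)} {v : H}
    (hv : ⟪S.φ θ, v⟫_ℂ = 0) (j : Fin m) :
    RCLike.re ⟪S.lift θ j, v⟫_ℂ = 2 * RCLike.re ⟪S.partialDeriv θ j, v⟫_ℂ := by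
  rw [PureStateModel.lift, inner_smul_left, inner_sub_left, inner_smul_left, hv]
  simp

namespace Measurement

variable {m : ℕ} {H : Type*} [NormedAddCommGroup H] [InnerProductSpace ℂ H] [CompleteSpace H]

theorem dist_zero (M : Measurement m H) : M.dist 0 = 0 := by
  ext B hB
  simp [M.dist_apply _ hB]

theorem measurable_coord_sub (θ : EuclideanSpace ℝ (Fin m)) (i : Fin m) :
    Measurable (fun x : EuclideanSpace ℝ (Fin m) => x i - θ i) := by
  fun_prop

theorem memLp_coord_sub (M : Measurement m H) {ψ : H}
    (h : ∫⁻ x, ‖x‖ₑ ^ 2 ∂(M.dist ψ) < ∞) (θ : EuclideanSpace ℝ (Fin m)) (i : Fin m) :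
    MemLp (fun x => x i - θ i) 2 (M.dist ψ) := by
  have h1 : MemLp (fun x : EuclideanSpace ℝ (Fin m) => x) 2 (M.dist ψ) := by
    refine ⟨by fun_prop, ?_⟩
    rw [eLpNorm_lt_top_iff_lintegral_rpow_enorm_lt_top (by simp) (by simp)]
    simpa using h
  have h2 : MemLp (fun x : EuclideanSpace ℝ (Fin m) => x i) 2 (M.dist ψ) :=
    h1.mono (by fun_prop) (Eventually.of_forall fun x => PiLp.norm_apply_le x i)
  exact h2.sub (memLp_const _)

theorem integral_coord_sub_sq_le (M : Measurement m H) {ψ : H} {C : ℝ≥0}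
    (h : ∫⁻ x, ‖x‖ₑ ^ 2 ∂(M.dist ψ) ≤ C) (θ : EuclideanSpace ℝ (Fin m)) (i : Fin m) :
    ∫ x, (x i - θ i) ^ 2 ∂(M.dist ψ) ≤ 2 * C + 2 * ‖θ‖ ^ 2 * ‖ψ‖ ^ 2 := by
  have h0 : ∀ x : EuclideanSpace ℝ (Fin m), ‖‖x‖ ^ 2‖ₑ = ‖x‖ₑ ^ 2 := fun x => by
    rw [enorm_pow, enorm_norm]
  have hi : Integrable (fun x : EuclideanSpace ℝ (Fin m) => ‖x‖ ^ 2) (M.dist ψ) := by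
    refine ⟨by fun_prop, ?_⟩
    rw [hasFiniteIntegral_def]
    simp only [h0]
    exact h.trans_lt ENNReal.coe_lt_top
  have h1 : ∫ x, ‖x‖ ^ 2 ∂(M.dist ψ) ≤ C := by
    have h2 := integral_norm_eq_lintegral_enorm hi.1
    simp only [h0, norm_pow, norm_norm] at h2
    rw [h2]
    exact ENNReal.toReal_le_of_le_ofReal C.2 (by simpa using h)
  calc ∫ x, (x i - θ i) ^ 2 ∂(M.dist ψ)
      ≤ ∫ x, (2 * ‖x‖ ^ 2 + 2 * ‖θ‖ ^ 2) ∂(M.dist ψ) := by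
        refine integral_mono_of_nonneg (Eventually.of_forall fun x => sq_nonneg _)
          ((hi.const_mul 2).add (integrable_const _)) (Eventually.of_forall fun x => ?_)
        have hx : (x i) ^ 2 ≤ ‖x‖ ^ 2 := by
          rw [← sq_abs]
          exact pow_le_pow_left₀ (abs_nonneg _) (PiLp.norm_apply_le x i) 2
        have ht : (θ i) ^ 2 ≤ ‖θ‖ ^ 2 := by
          rw [← sq_abs]
          exact pow_le_pow_left₀ (abs_nonneg _) (PiLp.norm_apply_le θ i) 2
        have := sq_nonneg (x i + θ i)
        simp only
        nlinarith
    _ = 2 * (∫ x, ‖x‖ ^ 2 ∂(M.dist ψ)) + ‖ψ‖ ^ 2 * (2 * ‖θ‖ ^ 2) := by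
        rw [integral_add (hi.const_mul 2) (integrable_const _), integral_const_mul,
          integral_const, dist_real_univ, smul_eq_mul]
    _ ≤ _ := by nlinarith

/-- The vectors for which a given function of the outcome is integrable. -/
def integrableSubmodule (M : Measurement m H) (f : EuclideanSpace ℝ (Fin m) → ℝ) :
    Submodule ℂ H where
  carrier := {ψ | Integrable f (M.dist ψ)}
  add_mem' ha hb := M.integrable_dist_add ha hb
  zero_mem' := by simp [dist_zero]
  smul_mem' c _ ha := M.integrable_dist_smul c ha

/-- The vectors with f integrable form a subspace W, and a quadratic form on a finite-dimensional
space is bounded. The bound is built up one basis vector of W at a time by `dist_add_le`; no moment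
assumption enters. -/
theorem exists_abs_integral_le (M : Measurement m H) [FiniteDimensional ℂ H]
    (f : EuclideanSpace ℝ (Fin m) → ℝ) :
    ∃ K : ℝ, ∀ ψ, Integrable f (M.dist ψ) → |∫ x, f x ∂(M.dist ψ)| ≤ K * ‖ψ‖ ^ 2 := by
  classical
  let W := M.integrableSubmodule f
  let b := stdOrthonormalBasis ℂ W
  have key : ∀ s : Finset (Fin (Module.finrank ℂ W)), ∃ K : ℝ, ∀ c : Fin (Module.finrank ℂ W) → ℂ,
      ∫ x, |f x| ∂(M.dist (∑ i ∈ s, c i • (b i : H))) ≤ K * ∑ i ∈ s, ‖c i‖ ^ 2 := by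
    intro s
    induction s using Finset.induction_on with
    | empty =>
      refine ⟨0, fun c => ?_⟩
      simp [dist_zero]
    | insert a s ha ih =>
      obtain ⟨K, hK⟩ := ih
      have hG : 0 ≤ ∫ x, |f x| ∂(M.dist (b a : H)) := integral_nonneg fun x => abs_nonneg _
      refine ⟨2 * ∫ x, |f x| ∂(M.dist (b a : H)) + 2 * |K|, fun c => ?_⟩
      have hS : 0 ≤ ∑ i ∈ s, ‖c i‖ ^ 2 := Finset.sum_nonneg fun i _ => by positivity
      rw [Finset.sum_insert ha, Finset.sum_insert ha]
      have h1 : Integrable f (M.dist (c a • (b a : H))) :=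
        W.smul_mem (c a) (b a).2
      have h2 : Integrable f (M.dist (∑ i ∈ s, c i • (b i : H))) :=
        W.sum_mem fun i _ => W.smul_mem (c i) (b i).2
      have h3 := integral_le_of_le_two_smul_add (M.dist_add_le _ _)
        (fun x => abs_nonneg (f x)) h1.abs h2.abs
      rw [integral_dist_smul] at h3
      have h4 := hK c
      have h5 : K * ∑ i ∈ s, ‖c i‖ ^ 2 ≤ |K| * ∑ i ∈ s, ‖c i‖ ^ 2 :=
        mul_le_mul_of_nonneg_right (le_abs_self K) hS
      have h6 : 0 ≤ |K| * ‖c a‖ ^ 2 := by positivity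
      have h7 := mul_nonneg hG hS
      nlinarith
  obtain ⟨K, hK⟩ := key Finset.univ
  refine ⟨K, fun ψ hψ => ?_⟩
  have h1 := hK fun i => ⟪b i, (⟨ψ, hψ⟩ : W)⟫_ℂ
  have h2 : ∑ i, ⟪b i, (⟨ψ, hψ⟩ : W)⟫_ℂ • (b i : H) = ψ := by
    have := congrArg Subtype.val (b.sum_repr' (⟨ψ, hψ⟩ : W))
    simpa using this
  rw [h2, b.sum_sq_norm_inner_right] at h1
  exact (abs_integral_le_integral_abs).trans h1

theorem isLittleO_integral_of_le {M : Measurement m H} {f : EuclideanSpace ℝ (Fin m) → ℝ}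
    {γ : ℝ → H} {d : H} (hγ : HasDerivAt γ d 0) {K : ℝ}
    (hK : ∀ ψ, Integrable f (M.dist ψ) → |∫ x, f x ∂(M.dist ψ)| ≤ K * ‖ψ‖ ^ 2)
    (hi : ∀ᶠ t in 𝓝 0, Integrable f (M.dist (γ t))) :
    (fun t => ∫ x, f x ∂(M.dist (γ t - γ 0))) =o[𝓝 0] (fun t : ℝ => t) := by
  have h0 := hi.self_of_nhds
  have hO : (fun t => γ t - γ 0) =O[𝓝 0] (fun t : ℝ => t) := by
    simpa using hγ.isBigO_sub
  have h1 : (fun t => ∫ x, f x ∂(M.dist (γ t - γ 0))) =O[𝓝 0] (fun t => ‖γ t - γ 0‖ ^ 2) := by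
    refine Asymptotics.IsBigO.of_bound K (hi.mono fun t ht => ?_)
    have := hK _ (M.integrable_dist_sub ht h0)
    simpa using this
  have h2 : (fun t => ‖γ t - γ 0‖ ^ 2) =O[𝓝 0] (fun t : ℝ => t ^ 2) := hO.norm_left.pow 2
  refine (h1.trans h2).trans_isLittleO ?_
  simpa using Asymptotics.isLittleO_pow_pow (𝕜 := ℝ) (m := 1) (n := 2) (by norm_num)

theorem exists_dist_real_lt (M : Measurement m H) {f : EuclideanSpace ℝ (Fin m) → ℝ}
    (hm : Measurable f) (ψ : H) {ε : ℝ} (hε : 0 < ε) :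
    ∃ R : ℝ, 0 ≤ R ∧ (M.dist ψ).real {x | R < |f x|} < ε := by
  have h : Tendsto (fun n : ℕ => M.dist ψ {x | (n : ℝ) < |f x|}) atTop (𝓝 0) := by
    have h1 := tendsto_measure_iInter_atTop (μ := M.dist ψ)
      (s := fun n : ℕ => {x | (n : ℝ) < |f x|})
      (fun n => (measurableSet_lt measurable_const hm.abs).nullMeasurableSet)
      (fun a b hab x (hx : (b : ℝ) < |f x|) =>
        show (a : ℝ) < |f x| from (Nat.cast_le.mpr hab).trans_lt hx) ⟨0, measure_ne_top _ _⟩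
    have h2 : (⋂ n : ℕ, {x | (n : ℝ) < |f x|}) = ∅ := by
      ext x
      simp only [Set.mem_iInter, Set.mem_ofPred_eq, Set.mem_empty_iff_false, iff_false, not_forall,
        not_lt]
      exact exists_nat_ge _
    rwa [h2, measure_empty] at h1
  have h3 := (ENNReal.tendsto_toReal ENNReal.zero_ne_top).comp h
  obtain ⟨n, hn⟩ := (h3.eventually (gt_mem_nhds (by simpa using hε))).exists
  exact ⟨n, Nat.cast_nonneg n, hn⟩

theorem dist_real_add_le (M : Measurement m H) {B : Set (EuclideanSpace ℝ (Fin m))}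
    (hB : MeasurableSet B) (a b : H) :
    (M.dist (a + b)).real B ≤ 2 * (M.dist a).real B + 2 * ‖b‖ ^ 2 := by
  have h1 := M.re_inner_op_add hB a b
  have h2 := M.two_mul_re_inner_op_le hB b a
  have h3 : (M.dist b).real B ≤ ‖b‖ ^ 2 := by
    rw [← M.dist_real_univ b]
    exact measureReal_mono (Set.subset_univ _)
  rw [M.dist_real _ hB] at h3 ⊢
  rw [M.dist_real _ hB]
  linarith

theorem abs_integral_le_truncate (M : Measurement m H) {f : EuclideanSpace ℝ (Fin m) → ℝ}
    (hm : Measurable f) {ψ : H} (hf : MemLp f 2 (M.dist ψ)) {R : ℝ} (hR : 0 ≤ R) {s : ℝ}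
    (hs : 0 < s) :
    |∫ x, f x ∂(M.dist ψ)| ≤ R * ‖ψ‖ ^ 2 + (2 * s)⁻¹ * (M.dist ψ).real {x | R < |f x|}
      + s / 2 * ∫ x, f x ^ 2 ∂(M.dist ψ) := by
  have hA : MeasurableSet {x | R < |f x|} := measurableSet_lt measurable_const hm.abs
  have hi1 : Integrable (fun _ : EuclideanSpace ℝ (Fin m) => R) (M.dist ψ) := integrable_const _
  have hi2 : Integrable ({x | R < |f x|}.indicator fun _ => (2 * s)⁻¹) (M.dist ψ) :=
    (integrable_const _).indicator hA
  have hi3 : Integrable (fun x => s / 2 * f x ^ 2) (M.dist ψ) := hf.integrable_sq.const_mul _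
  refine abs_integral_le_integral_abs.trans ?_
  have h : ∫ x, |f x| ∂(M.dist ψ) ≤
      ∫ x, (R + {x | R < |f x|}.indicator (fun _ => (2 * s)⁻¹) x + s / 2 * f x ^ 2)
        ∂(M.dist ψ) := by
    refine integral_mono (hf.integrable (by norm_num)).abs ((hi1.add hi2).add hi3) fun x => ?_
    have hsq : 0 ≤ s / 2 * f x ^ 2 := by positivity
    by_cases hx : R < |f x|
    -- Beyond R, completing the square trades |f| for a constant, charged to the tail probability,
    -- and a small multiple of f².
    · have h1 : |f x| ≤ (2 * s)⁻¹ + s / 2 * f x ^ 2 := by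
        rw [← sq_abs (f x)]
        have h2 : (2 * s)⁻¹ + s / 2 * |f x| ^ 2 - |f x| = (s * |f x| - 1) ^ 2 / (2 * s) := by
          field_simp
          ring
        have h3 : 0 ≤ (s * |f x| - 1) ^ 2 / (2 * s) := by positivity
        linarith
      simp only [Set.indicator_of_mem (show x ∈ {x | R < |f x|} from hx)]
      linarith
    · simp only [Set.indicator_of_notMem (show x ∉ {x | R < |f x|} from hx)]
      linarith [not_lt.mp hx]
  refine h.trans_eq ?_
  have h1 := integral_add (hi1.add hi2) hi3
  simp only [Pi.add_apply] at h1
  rw [h1, integral_add hi1 hi2, integral_const_mul, integral_indicator hA, setIntegral_const,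
    integral_const, dist_real_univ, smul_eq_mul, smul_eq_mul]
  ring

/-- Here the form need not be bounded by a multiple of ‖ψ‖². Write γ t - γ 0 = t d + r with ‖r‖ =
o(t) and truncate f at a level R chosen from the distribution of the fixed vector d. In
`abs_integral_le_truncate` with s = η|t|, the bounded part is O(t²), the tail part is at most
(2η|t|)⁻¹ times a small multiple of t², and the second moment part is O(η|t|). -/
theorem isLittleO_integral_of_bounded {M : Measurement m H} {f : EuclideanSpace ℝ (Fin m) → ℝ}
    (hm : Measurable f) {γ : ℝ → H} {d : H} (hγ : HasDerivAt γ d 0) {D : ℝ}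
    (hi : ∀ᶠ t in 𝓝 0, MemLp f 2 (M.dist (γ t)) ∧ ∫ x, f x ^ 2 ∂(M.dist (γ t)) ≤ D) :
    (fun t => ∫ x, f x ∂(M.dist (γ t - γ 0))) =o[𝓝 0] (fun t : ℝ => t) := by
  have h0 := hi.self_of_nhds
  have hD : 0 ≤ D := (integral_nonneg fun x => sq_nonneg _).trans h0.2
  rw [Asymptotics.isLittleO_iff]
  intro ε hε
  -- η makes the second moment term at most ε/4 · |t|; the bounded part takes another ε/4 and the
  -- tail ε/2. The + 1 covers D = 0.
  let η : ℝ := ε / (8 * (D + 1))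
  have hη : 0 < η := by positivity
  have hηD : 2 * D * η ≤ ε / 4 := by
    have : η * (8 * (D + 1)) = ε := by simp only [η]; field_simp
    nlinarith
  obtain ⟨R, hR, hRd⟩ := M.exists_dist_real_lt hm d (ε := η * ε / 4) (by positivity)
  have hA : MeasurableSet {x | R < |f x|} := measurableSet_lt measurable_const hm.abs
  have hO : (fun t => γ t - γ 0) =O[𝓝 0] (fun t : ℝ => t) := by
    simpa using hγ.isBigO_sub
  have hO2 : (fun t => ‖γ t - γ 0‖ ^ 2) =o[𝓝 0] (fun t : ℝ => t) := by
    refine (hO.norm_left.pow 2).trans_isLittleO ?_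
    simpa using Asymptotics.isLittleO_pow_pow (𝕜 := ℝ) (m := 1) (n := 2) (by norm_num)
  have hr : (fun t : ℝ => γ t - γ 0 - t • d) =o[𝓝 0] (fun t : ℝ => t) := by
    simpa using hγ.isLittleO
  have e1 := Asymptotics.isLittleO_iff.mp hO2 (c := ε / (4 * (R + 1))) (by positivity)
  have e2 := Asymptotics.isLittleO_iff.mp hr (c := √(η * ε / 4)) (by positivity)
  filter_upwards [hi, e1, e2] with t ht ht1 ht2
  by_cases ht0 : t = 0
  · subst ht0
    simp [dist_zero]
  have htp : 0 < |t| := abs_pos.mpr ht0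
  have hmem : MemLp f 2 (M.dist (γ t - γ 0)) := by
    rw [memLp_two_iff_integrable_sq hm.aestronglyMeasurable]
    exact M.integrable_dist_sub ht.1.integrable_sq h0.1.integrable_sq
  have hsq : ∫ x, f x ^ 2 ∂(M.dist (γ t - γ 0)) ≤ 4 * D := by
    have := integral_le_of_le_two_smul_add (M.dist_sub_le (γ t) (γ 0)) (fun x => sq_nonneg (f x))
      ht.1.integrable_sq h0.1.integrable_sq
    linarith [ht.2, h0.2]
  have hmain := M.abs_integral_le_truncate hm hmem hR (s := η * |t|) (by positivity)
  have hsplit : (M.dist (γ t - γ 0)).real {x | R < |f x|} ≤ t ^ 2 * (η * ε) := by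
    have h1 := M.dist_real_add_le hA ((t : ℂ) • d) (γ t - γ 0 - t • d)
    have h2 : (t : ℂ) • d + (γ t - γ 0 - t • d) = γ t - γ 0 := by
      rw [Complex.coe_smul]; abel
    have h3 : (M.dist ((t : ℂ) • d)).real {x | R < |f x|}
        = t ^ 2 * (M.dist d).real {x | R < |f x|} := by
      rw [dist_smul, measureReal_ennreal_smul_apply, ENNReal.toReal_ofReal (by positivity)]
      simp
    have h4 : ‖γ t - γ 0 - t • d‖ ^ 2 ≤ η * ε / 4 * t ^ 2 := by
      have := pow_le_pow_left₀ (norm_nonneg _) ht2 2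
      rwa [mul_pow, Real.sq_sqrt (by positivity), Real.norm_eq_abs, sq_abs] at this
    rw [h2, h3] at h1
    have h5 := mul_le_mul_of_nonneg_left hRd.le (sq_nonneg t)
    linarith
  have hterm1 : R * ‖γ t - γ 0‖ ^ 2 ≤ ε / 4 * |t| := by
    rw [norm_pow, norm_norm, Real.norm_eq_abs] at ht1
    calc R * ‖γ t - γ 0‖ ^ 2 ≤ (R + 1) * (ε / (4 * (R + 1)) * |t|) := by
          refine mul_le_mul (by linarith) ht1 (by positivity) (by positivity)
      _ = ε / 4 * |t| := by field_simp
  have hterm2 : (2 * (η * |t|))⁻¹ * (M.dist (γ t - γ 0)).real {x | R < |f x|} ≤ ε / 2 * |t| := by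
    calc _ ≤ (2 * (η * |t|))⁻¹ * (t ^ 2 * (η * ε)) :=
          mul_le_mul_of_nonneg_left hsplit (by positivity)
      _ = ε / 2 * |t| := by
          rw [← sq_abs t]; field_simp
  have hterm3 : η * |t| / 2 * ∫ x, f x ^ 2 ∂(M.dist (γ t - γ 0)) ≤ ε / 4 * |t| := by
    calc _ ≤ η * |t| / 2 * (4 * D) := mul_le_mul_of_nonneg_left hsq (by positivity)
      _ = 2 * D * η * |t| := by ring
      _ ≤ ε / 4 * |t| := mul_le_mul_of_nonneg_right hηD htp.le
  rw [Real.norm_eq_abs, Real.norm_eq_abs]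
  linarith

variable {M : Measurement m H} {S : PureStateModel m H} {θ : EuclideanSpace ℝ (Fin m)}

theorem tendsto_add_smul_single (θ : EuclideanSpace ℝ (Fin m)) (j : Fin m) :
    Tendsto (fun t : ℝ => θ + t • EuclideanSpace.single j (1 : ℝ)) (𝓝 0) (𝓝 θ) := by
  have h : Continuous fun t : ℝ => θ + t • EuclideanSpace.single j (1 : ℝ) := by fun_prop
  simpa using h.tendsto 0

theorem mean_eq_add (hθ : θ ∈ S.Θ) {θ₀ : EuclideanSpace ℝ (Fin m)} {i : Fin m}
    (hi : Integrable (fun x => x i - θ₀ i) (M.dist (S.φ θ))) :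
    M.mean S θ i = ∫ x, (x i - θ₀ i) ∂(M.dist (S.φ θ)) + θ₀ i := by
  have h : ∀ x : EuclideanSpace ℝ (Fin m), x i = (x i - θ₀ i) + θ₀ i := fun x => by ring
  rw [mean, integral_congr_ae (Eventually.of_forall h), integral_add hi (integrable_const _),
    integral_const, dist_real_univ, S.norm_φ θ hθ]
  simp

theorem HasLocallyBoundedSecondMoments.eventually_lt_top
    (h : M.HasLocallyBoundedSecondMoments S θ) :
    ∀ᶠ θ' in 𝓝 θ, M.HasFiniteSecondMoments S θ' := by
  obtain ⟨C, hC⟩ := h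
  exact hC.mono fun θ' h' => h'.trans_lt ENNReal.coe_lt_top

/-- The derivative of the mean may be taken under the integral sign. -/
theorem IsIntegral.hasLineDerivAt_mean (hθ : θ ∈ S.Θ) {i : Fin m} {v : H}
    (hv : M.IsIntegral (fun x => x i - θ i) (S.φ θ) v)
    (hi : ∀ᶠ θ' in 𝓝 θ, Integrable (fun x => x i) (M.dist (S.φ θ')))
    (hb : FiniteDimensional ℂ H ∨ M.HasLocallyBoundedSecondMoments S θ) (j : Fin m) :
    HasLineDerivAt ℝ (fun θ' => M.mean S θ' i) (2 * RCLike.re ⟪S.partialDeriv θ j, v⟫_ℂ) θ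
      (EuclideanSpace.single j 1) := by
  have hm := measurable_coord_sub θ i
  have hlim := tendsto_add_smul_single θ j
  have hΘ : ∀ᶠ θ' in 𝓝 θ, θ' ∈ S.Θ := S.isOpen_Θ.mem_nhds hθ
  have hi' : ∀ᶠ θ' in 𝓝 θ, Integrable (fun x => x i - θ i) (M.dist (S.φ θ')) :=
    hi.mono fun θ' h' => h'.sub (integrable_const _)
  let γ : ℝ → H := fun t => S.φ (θ + t • EuclideanSpace.single j (1 : ℝ))
  have hγ0 : γ 0 = S.φ θ := by simp [γ]
  have hγ : HasDerivAt γ (S.partialDeriv θ j) 0 :=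
    (S.differentiableAt_φ θ hθ).hasFDerivAt.hasLineDerivAt _
  have hsmall : (fun t => ∫ x, (x i - θ i) ∂(M.dist (γ t - γ 0))) =o[𝓝 0] (fun t : ℝ => t) := by
    rcases hb with hfd | ⟨C, hC⟩
    · obtain ⟨K, hK⟩ := M.exists_abs_integral_le (fun x => x i - θ i)
      exact isLittleO_integral_of_le hγ hK (hlim.eventually hi')
    · refine isLittleO_integral_of_bounded hm hγ (D := 2 * C + 2 * ‖θ‖ ^ 2) ?_
      filter_upwards [hlim.eventually hC, hlim.eventually hΘ] with t h1 h2
      refine ⟨M.memLp_coord_sub (h1.trans_lt ENNReal.coe_lt_top) θ i, ?_⟩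
      have := M.integral_coord_sub_sq_le h1 θ i
      rwa [S.norm_φ _ h2, one_pow, mul_one] at this
  -- Exact second-order expansion of the mean about φ: constant, linear term, and the quadratic form
  -- at the increment.
  have heq : ∀ᶠ t : ℝ in 𝓝 0, M.mean S (θ + t • EuclideanSpace.single j (1 : ℝ)) i =
      (∫ x, (x i - θ i) ∂(M.dist (S.φ θ)) + θ i) + 2 * RCLike.re ⟪γ t - γ 0, v⟫_ℂ
        + ∫ x, (x i - θ i) ∂(M.dist (γ t - γ 0)) := by
    filter_upwards [hlim.eventually hi', hlim.eventually hΘ] with t h1 h2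
    have h3 : Integrable (fun x => x i - θ i) (M.dist (γ t - γ 0)) :=
      M.integrable_dist_sub h1 (hγ0 ▸ hi'.self_of_nhds)
    have h4 := hv.integral_dist_add hm h3
    have h5 : S.φ θ + (γ t - γ 0) = S.φ (θ + t • EuclideanSpace.single j (1 : ℝ)) := by
      rw [hγ0]; simp [γ]
    rw [h5] at h4
    rw [mean_eq_add h2 h1, h4]
    ring
  have hd1 : HasDerivAt (fun t => RCLike.re ⟪γ t - γ 0, v⟫_ℂ)
      (RCLike.re ⟪S.partialDeriv θ j, v⟫_ℂ) 0 := by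
    have h1 := (hγ.sub_const (γ 0)).inner ℂ (hasDerivAt_const (0 : ℝ) v)
    have h2 := (RCLike.reCLM (K := ℂ)).hasFDerivAt.comp_hasDerivAt (0 : ℝ) h1
    simp only [inner_zero_right, zero_add] at h2
    exact h2
  have hd2 : HasDerivAt (fun t => ∫ x, (x i - θ i) ∂(M.dist (γ t - γ 0))) 0 0 := by
    rw [hasDerivAt_iff_isLittleO]
    simpa [dist_zero] using hsmall
  have hd := ((hd1.const_mul 2).const_add
    (∫ x, (x i - θ i) ∂(M.dist (S.φ θ)) + θ i)).add hd2
  rw [add_zero] at hd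
  exact hd.congr_of_eventuallyEq heq

theorem IsLocallyUnbiasedAt.hasLocallyUnbiasedEstimationVectors (hθ : θ ∈ S.Θ)
    (h : M.IsLocallyUnbiasedAt S θ) (hfin : M.HasFiniteSecondMoments S θ)
    (hb : FiniteDimensional ℂ H ∨ M.HasLocallyBoundedSecondMoments S θ) :
    M.HasLocallyUnbiasedEstimationVectors S θ := by
  intro i
  obtain ⟨hi, hmean, hder⟩ := h i
  have hm := measurable_coord_sub θ i
  obtain ⟨v, hv⟩ := M.exists_isIntegral hm (M.memLp_coord_sub hfin θ i)
  have h0 : ⟪S.φ θ, v⟫_ℂ = 0 := by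
    have h1 := mean_eq_add hθ (hv.1.integrable (by norm_num))
    rw [hv.inner_self hm, Complex.ofReal_eq_zero]
    linarith
  refine ⟨v, hv, h0, fun j => ?_⟩
  rw [PureStateModel.re_inner_lift h0]
  exact HasDerivAt.unique (hv.hasLineDerivAt_mean hθ hi hb j) (hder j)

theorem HasLocallyUnbiasedEstimationVectors.isLocallyUnbiasedAt (hθ : θ ∈ S.Θ)
    (h : M.HasLocallyUnbiasedEstimationVectors S θ)
    (hb : M.HasLocallyBoundedSecondMoments S θ) :
    M.IsLocallyUnbiasedAt S θ := by
  intro i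
  obtain ⟨v, hv, h0, hl⟩ := h i
  have hi : ∀ᶠ θ' in 𝓝 θ, Integrable (fun x => x i) (M.dist (S.φ θ')) :=
    hb.eventually_lt_top.mono fun θ' h' => by
      simpa using (M.memLp_coord_sub h' 0 i).integrable (by norm_num)
  refine ⟨hi, ?_, fun j => ?_⟩
  · rw [mean_eq_add hθ (hv.1.integrable (by norm_num))]
    have h1 := hv.inner_self (measurable_coord_sub θ i)
    rw [h0] at h1
    rw [Complex.ofReal_eq_zero.mp h1.symm, zero_add]
  · have := hv.hasLineDerivAt_mean hθ hi (Or.inr hb) j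
    rwa [← PureStateModel.re_inner_lift h0, hl j] at this

end Measurement

/-! ### Measurements with finitely many outcomes -/

theorem hasSum_indicator_iUnion_apply {α E : Type*} [AddCommMonoid E] [TopologicalSpace E]
    {B : ℕ → Set α} (hB : Pairwise fun i j => Disjoint (B i) (B j)) (f : α → E) (a : α) :
    HasSum (fun i => (B i).indicator f a) ((⋃ i, B i).indicator f a) := by
  by_cases ha : a ∈ ⋃ i, B i
  · obtain ⟨i, hi⟩ := Set.mem_iUnion.mp ha
    rw [Set.indicator_of_mem ha, ← Set.indicator_of_mem hi f]
    refine hasSum_single i fun j hj => Set.indicator_of_notMem (fun h => ?_) f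
    exact Set.disjoint_left.mp (hB hj) h hi
  · rw [Set.indicator_of_notMem ha]
    have h0 : ∀ i, (B i).indicator f a = 0 := fun i =>
      Set.indicator_of_notMem (fun h => ha (Set.mem_iUnion.mpr ⟨i, h⟩)) f
    simp only [h0]
    exact hasSum_zero

namespace Measurement

variable {m : ℕ} {H : Type*} [NormedAddCommGroup H] [InnerProductSpace ℂ H] [CompleteSpace H]
  {ι : Type*} [Fintype ι]

/-- The measurement whose outcome is `a k` when the projective measurement `P` has outcome `k`. -/
def discrete (P : ι → H →L[ℂ] H) (a : ι → EuclideanSpace ℝ (Fin m))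
    (hP : ∀ k, IsStarProjection (P k)) (hsum : ∑ k, P k = 1) : Measurement m H where
  op B := ∑ k, B.indicator (fun _ => P k) (a k)
  isPositive B _ := by
    rw [← ContinuousLinearMap.nonneg_iff_isPositive]
    exact Finset.sum_nonneg fun k _ => Set.indicator_nonneg (fun _ _ => (hP k).nonneg) _
  op_empty := by simp
  op_univ := by simpa using hsum
  op_iUnion B _ hd ψ := by
    have h := hasSum_sum (s := Finset.univ)
      fun (k : ι) _ => hasSum_indicator_iUnion_apply hd (fun _ => P k ψ) (a k)
    have e : ∀ B : Set (EuclideanSpace ℝ (Fin m)), (∑ k, B.indicator (fun _ => P k) (a k)) ψ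
        = ∑ k, B.indicator (fun _ => P k ψ) (a k) := by
      intro B
      rw [_root_.sum_apply]
      refine Finset.sum_congr rfl fun k _ => ?_
      by_cases hk : a k ∈ B <;> simp [hk]
    simpa only [e] using h

variable {P : ι → H →L[ℂ] H} {a : ι → EuclideanSpace ℝ (Fin m)}
  {hP : ∀ k, IsStarProjection (P k)} {hsum : ∑ k, P k = 1}

theorem discrete_op_apply (B : Set (EuclideanSpace ℝ (Fin m))) (ψ : H) :
    (discrete P a hP hsum).op B ψ = ∑ k, B.indicator (fun _ => P k ψ) (a k) := by
  rw [discrete, _root_.sum_apply]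
  refine Finset.sum_congr rfl fun k _ => ?_
  by_cases hk : a k ∈ B <;> simp [hk]

theorem discrete_isSimple (hPP : Pairwise fun k l => P k * P l = 0) :
    (discrete P a hP hsum).IsSimple := by
  classical
  intro B _
  constructor
  · change (∑ k, B.indicator (fun _ => P k) (a k)) * (∑ k, B.indicator (fun _ => P k) (a k))
      = ∑ k, B.indicator (fun _ => P k) (a k)
    rw [Finset.sum_mul]
    refine Finset.sum_congr rfl fun k _ => ?_
    rw [Finset.mul_sum, Finset.sum_eq_single k]
    · by_cases hk : a k ∈ B
      · simpa [hk] using (hP k).isIdempotentElem.eq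
      · simp [hk]
    · intro l _ hl
      by_cases hk : a k ∈ B <;> by_cases hl' : a l ∈ B <;> simp [hk, hl', hPP hl.symm]
    · simp
  · refine isSelfAdjoint_sum _ fun k _ => ?_
    by_cases hk : a k ∈ B
    · simpa [hk] using (hP k).isSelfAdjoint
    · simp [hk]

theorem simpleIntegral_discrete (s : SimpleFunc (EuclideanSpace ℝ (Fin m)) ℝ) (ψ : H) :
    (discrete P a hP hsum).simpleIntegral s ψ = ∑ k, (s (a k) : ℂ) • P k ψ := by
  simp only [simpleIntegral, discrete_op_apply, Finset.smul_sum]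
  rw [Finset.sum_comm]
  refine Finset.sum_congr rfl fun k _ => ?_
  rw [Finset.sum_eq_single (s (a k))]
  · simp
  · intro c _ hc
    rw [Set.indicator_of_notMem (fun h => hc h.symm), smul_zero]
  · intro h
    exact (h (s.mem_range_self _)).elim

theorem dist_discrete (ψ : H) :
    (discrete P a hP hsum).dist ψ
      = ∑ k, ENNReal.ofReal (‖P k ψ‖ ^ 2) • Measure.dirac (a k) := by
  have hre : ∀ k, RCLike.re ⟪ψ, P k ψ⟫_ℂ = ‖P k ψ‖ ^ 2 := by
    intro k
    have h1 : ⟪P k ψ, P k ψ⟫_ℂ = ⟪ψ, P k (P k ψ)⟫_ℂ :=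
      (ContinuousLinearMap.isSelfAdjoint_iff_isSymmetric.mp (hP k).isSelfAdjoint) ψ (P k ψ)
    have h2 : P k (P k ψ) = P k ψ := congrArg (fun T => T ψ) (hP k).isIdempotentElem.eq
    rw [h2] at h1
    rw [← h1]
    exact inner_self_eq_norm_sq (𝕜 := ℂ) _
  ext B hB
  rw [dist_apply _ _ hB, discrete_op_apply, inner_sum, map_sum,
    Measure.finsetSum_apply, ENNReal.ofReal_sum_of_nonneg]
  · refine Finset.sum_congr rfl fun k _ => ?_
    rw [Measure.smul_apply, Measure.dirac_apply' _ hB]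
    by_cases hk : a k ∈ B
    · simp [hk, ← hre k]
    · simp [hk]
  · intro k _
    by_cases hk : a k ∈ B
    · simp only [hk, Set.indicator_of_mem, hre]
      positivity
    · simp [hk]

theorem integrable_dist_discrete (ψ : H) (f : EuclideanSpace ℝ (Fin m) → ℝ) :
    Integrable f ((discrete P a hP hsum).dist ψ) := by
  rw [dist_discrete]
  exact integrable_finsetSum_measure.mpr fun k _ =>
    (integrable_dirac (by simp)).smul_measure (by simp)

theorem integral_dist_discrete (ψ : H) (f : EuclideanSpace ℝ (Fin m) → ℝ) :
    ∫ x, f x ∂((discrete P a hP hsum).dist ψ) = ∑ k, ‖P k ψ‖ ^ 2 * f (a k) := by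
  rw [dist_discrete, integral_finsetSum_measure fun k _ =>
    (integrable_dirac (by simp)).smul_measure (by simp)]
  refine Finset.sum_congr rfl fun k _ => ?_
  rw [integral_smul_measure, integral_dirac, ENNReal.toReal_ofReal (by positivity), smul_eq_mul]

/-- `IsIntegral` concerns all approximating sequences; since the integral exists, it is enough to
compute the limit along one that also converges pointwise at the atoms. -/
theorem isIntegral_discrete {f : EuclideanSpace ℝ (Fin m) → ℝ} (hm : Measurable f) (ψ : H) :
    (discrete P a hP hsum).IsIntegral f ψ (∑ k, (f (a k) : ℂ) • P k ψ) := by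
  have hf : MemLp f 2 ((discrete P a hP hsum).dist ψ) :=
    (memLp_two_iff_integrable_sq hm.aestronglyMeasurable).mpr (integrable_dist_discrete ψ _)
  obtain ⟨v, hv⟩ := exists_isIntegral _ hm hf
  obtain ⟨s, hs, -, hL⟩ := exists_simpleFunc_approx hm
  have h1 := hv.2 s (hL _ hf)
  simp only [simpleIntegral_discrete] at h1
  have h2 : Tendsto (fun n => ∑ k, (s n (a k) : ℂ) • P k ψ) atTop
      (𝓝 (∑ k, (f (a k) : ℂ) • P k ψ)) :=
    tendsto_finsetSum _ fun k _ =>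
      ((Complex.continuous_ofReal.tendsto _).comp (hs (a k))).smul_const _
  rwa [← tendsto_nhds_unique h1 h2]

theorem hasLocallyBoundedSecondMoments_discrete {S : PureStateModel m H}
    {θ : EuclideanSpace ℝ (Fin m)} (hθ : θ ∈ S.Θ) :
    (discrete P a hP hsum).HasLocallyBoundedSecondMoments S θ := by
  refine ⟨∑ k, ‖a k‖₊ ^ 2, ?_⟩
  filter_upwards [S.isOpen_Θ.mem_nhds hθ] with θ' hθ'
  rw [dist_discrete, lintegral_finsetSum_measure]
  push_cast
  refine Finset.sum_le_sum fun k _ => ?_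
  rw [lintegral_smul_measure, lintegral_dirac' _ (by fun_prop), smul_eq_mul]
  have h1 : ‖P k (S.φ θ')‖ ≤ 1 := by
    have := (P k).le_of_opNorm_le ((hP k).norm_le) (S.φ θ')
    rwa [S.norm_φ θ' hθ', one_mul] at this
  calc _ ≤ 1 * ‖a k‖ₑ ^ 2 := by
        gcongr
        rw [ENNReal.ofReal_le_one]
        exact pow_le_one₀ (norm_nonneg _) h1
    _ = _ := by rw [one_mul]; rfl

end Measurement

/-! ### Gram matrices and real orthonormal systems -/

theorem integral_norm_sum_mul_sq {α ι : Type*} [MeasurableSpace α] [Fintype ι] {μ : Measure α}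
    {f : ι → α → ℝ} (hf : ∀ i, MemLp (f i) 2 μ) (c : ι → ℂ) :
    ((∫ x, ‖∑ i, c i * f i x‖ ^ 2 ∂μ : ℝ) : ℂ)
      = ∑ i, ∑ j, star (c i) * ((∫ x, f i x * f j x ∂μ : ℝ) : ℂ) * c j := by
  have hi : ∀ i j, Integrable (fun x => star (c i) * ((f i x * f j x : ℝ) : ℂ) * c j) μ :=
    fun i j => ((((hf i).integrable_mul (hf j)).ofReal).const_mul _).mul_const _
  have h1 : ∀ i j, star (c i) * ((∫ x, f i x * f j x ∂μ : ℝ) : ℂ) * c j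
      = ∫ x, star (c i) * ((f i x * f j x : ℝ) : ℂ) * c j ∂μ := fun i j => by
    rw [integral_mul_const, integral_const_mul, integral_complex_ofReal]
  simp only [h1]
  rw [← integral_complex_ofReal]
  simp_rw [← integral_finsetSum Finset.univ fun j _ => hi _ j]
  rw [← integral_finsetSum Finset.univ fun i _ => integrable_finsetSum _ fun j _ => hi i j]
  refine integral_congr_ae (Eventually.of_forall fun x => ?_)
  simp only [Complex.ofReal_pow]
  rw [← Complex.conj_mul', map_sum, Finset.sum_mul_sum]
  refine Finset.sum_congr rfl fun i _ => Finset.sum_congr rfl fun j _ => ?_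
  simp only [map_mul, Complex.conj_ofReal, Complex.ofReal_mul, Complex.star_def]
  ring

section InnerProduct

variable {H : Type*} [NormedAddCommGroup H] [InnerProductSpace ℂ H]

theorem norm_sum_smul_sq {ι : Type*} [Fintype ι] (v : ι → H) (c : ι → ℂ) :
    ((‖∑ i, c i • v i‖ ^ 2 : ℝ) : ℂ) = ∑ i, ∑ j, star (c i) * ⟪v i, v j⟫_ℂ * c j := by
  have h := inner_self_eq_norm_sq_to_K (𝕜 := ℂ) (∑ i, c i • v i)
  rw [Complex.ofReal_pow]
  refine h.symm.trans ?_
  rw [sum_inner]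
  refine Finset.sum_congr rfl fun i _ => ?_
  rw [inner_sum]
  refine Finset.sum_congr rfl fun j _ => ?_
  rw [inner_smul_left, inner_smul_right, Complex.star_def]
  ring

theorem exists_orthonormal_orthogonal {n m : ℕ}
    (hdim : ((n + m : ℕ) : Cardinal) ≤ Module.rank ℂ H) (L : Submodule ℂ H)
    [FiniteDimensional ℂ L] (hL : Module.finrank ℂ L ≤ n) :
    ∃ e : Fin m → H, Orthonormal ℂ e ∧ ∀ k, e k ∈ Lᗮ := by
  have h1 : (m : Cardinal) ≤ Module.rank ℂ Lᗮ := by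
    rw [← (L.quotientEquivOfIsCompl Lᗮ L.isCompl_orthogonal).rank_eq]
    -- Cardinals do not cancel in general, but if the rank of Lᗮ were below m, all ranks involved
    -- would be finite.
    by_contra hlt
    rw [not_le] at hlt
    obtain ⟨k, hk⟩ := Cardinal.lt_aleph0.mp (hlt.trans (Cardinal.natCast_lt_aleph0))
    rw [← L.rank_quotient_add_rank, hk, ← Module.finrank_eq_rank] at hdim
    rw [hk] at hlt
    norm_cast at hdim hlt
    omega
  obtain ⟨s, hs, hli⟩ := le_rank_iff_exists_linearIndependent_finset.mp h1
  have e : Fin m ≃ s := (Fintype.equivFinOfCardEq (by simpa using hs)).symm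
  have hli' : LinearIndependent ℂ fun k => ((e k : s) : Lᗮ) := hli.comp e e.injective
  refine ⟨fun k => ((InnerProductSpace.gramSchmidtNormed ℂ (fun k => ((e k : s) : Lᗮ)) k : Lᗮ) : H),
    ?_, fun k => SetLike.coe_mem _⟩
  exact (InnerProductSpace.gramSchmidtNormed_orthonormal hli').comp_linearIsometry
    (Lᗮ.subtypeₗᵢ)

open scoped ComplexOrder MatrixOrder in
-- Take y i = z i + w i with z i the projection of x i to L and w i in Lᗮ. The w i are invisible to
-- L, so they may be chosen freely to fill the gap G = V - Gram(z), which is positive semidefinite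
-- because Gram(z) ≤ Gram(x) ≤ V.
theorem exists_gram_eq {n m : ℕ} (hdim : ((n + m : ℕ) : Cardinal) ≤ Module.rank ℂ H)
    (L : Submodule ℂ H) [FiniteDimensional ℂ L] (hL : Module.finrank ℂ L ≤ n) (x : Fin m → H)
    (V : Matrix (Fin m) (Fin m) ℝ) (hV : ∀ i j, V i j = V j i)
    (hle : ∀ c : Fin m → ℂ, ∃ r : ℝ, ‖∑ i, c i • x i‖ ^ 2 ≤ r ∧
      (r : ℂ) = ∑ i, ∑ j, star (c i) * (V i j : ℂ) * c j) :
    ∃ y : Fin m → H, (∀ u ∈ L, ∀ i, ⟪u, y i⟫_ℂ = ⟪u, x i⟫_ℂ) ∧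
      ∀ i j, ⟪y i, y j⟫_ℂ = V i j := by
  obtain ⟨e, he, heL⟩ := exists_orthonormal_orthogonal hdim L hL
  let z : Fin m → H := fun i => L.starProjection (x i)
  have hz : ∀ c : Fin m → ℂ, ∑ i, c i • z i = L.starProjection (∑ i, c i • x i) := fun c => by
    simp [z, map_sum]
  let G : Matrix (Fin m) (Fin m) ℂ := Matrix.of fun i j => (V i j : ℂ) - ⟪z i, z j⟫_ℂ
  have hG : G.PosSemidef := by
    refine Matrix.PosSemidef.of_dotProduct_mulVec_nonneg ?_ fun c => ?_
    · ext i j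
      simp [G, Matrix.conjTranspose_apply, hV j i]
    · obtain ⟨r, hr, hrV⟩ := hle c
      have h1 : star c ⬝ᵥ G.mulVec c = ((r - ‖∑ i, c i • z i‖ ^ 2 : ℝ) : ℂ) := by
        rw [Complex.ofReal_sub, norm_sum_smul_sq, hrV, ← Finset.sum_sub_distrib, dotProduct]
        refine Finset.sum_congr rfl fun i _ => ?_
        rw [Matrix.mulVec, dotProduct, Finset.mul_sum, ← Finset.sum_sub_distrib]
        refine Finset.sum_congr rfl fun j _ => ?_
        simp only [G, Matrix.of_apply, Pi.star_apply]
        ring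
      rw [h1, Complex.zero_le_real, sub_nonneg, hz]
      refine le_trans ?_ hr
      exact pow_le_pow_left₀ (norm_nonneg _) (L.norm_starProjection_apply_le _) 2
  -- Factor G = B* B; the columns of B are the coordinates of the w i in the orthonormal system e,
  -- so G has size m and m vectors e suffice.
  obtain ⟨B, hB⟩ := CStarAlgebra.nonneg_iff_eq_star_mul_self.mp hG.nonneg
  let w : Fin m → H := fun i => ∑ k, B k i • e k
  have hwL : ∀ i, w i ∈ Lᗮ := fun i => Lᗮ.sum_mem fun k _ => Lᗮ.smul_mem _ (heL k)
  have hw : ∀ i j, ⟪w i, w j⟫_ℂ = G i j := by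
    intro i j
    rw [hB, Matrix.mul_apply]
    simp only [w]
    rw [he.inner_sum]
    rfl
  have hzL : ∀ i, z i ∈ L := fun i => L.starProjection_apply_mem _
  refine ⟨fun i => z i + w i, fun u hu i => ?_, fun i j => ?_⟩
  · rw [inner_add_right, L.inner_right_of_mem_orthogonal hu (hwL i), add_zero]
    have h2 : ⟪u, x i - z i⟫_ℂ = 0 :=
      L.inner_right_of_mem_orthogonal hu (L.sub_starProjection_mem_orthogonal _)
    rw [inner_sub_right, sub_eq_zero] at h2
    exact h2.symm
  · rw [inner_add_right, inner_add_left, inner_add_left,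
      L.inner_right_of_mem_orthogonal (hzL i) (hwL j),
      L.inner_left_of_mem_orthogonal (hzL j) (hwL i), hw]
    simp [G]

theorem exists_orthonormalBasis_inner_ne_zero {E : Type*} [NormedAddCommGroup E]
    [InnerProductSpace ℝ E] [FiniteDimensional ℝ E] {φ : E} (hφ : ‖φ‖ = 1) :
    ∃ b : OrthonormalBasis (Fin (Module.finrank ℝ E)) ℝ E, ∀ k, ⟪b k, φ⟫_ℝ ≠ 0 := by
  let u := stdOrthonormalBasis ℝ E
  have : Nontrivial E := ⟨φ, 0, fun h => by simp [h] at hφ⟩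
  have hn : 0 < Module.finrank ℝ E := Module.finrank_pos
  have hn' : (0 : ℝ) < Module.finrank ℝ E := by exact_mod_cast hn
  let r : ℝ := (√(Module.finrank ℝ E))⁻¹
  have hr : r ≠ 0 := by positivity
  let g : E := ∑ k, r • u k
  have hgk : ∀ k, ⟪u k, g⟫_ℝ = r := fun k => by
    simpa [g] using u.orthonormal.inner_right_fintype (fun _ => r) k
  have hg : ‖g‖ = 1 := by
    have h := u.sum_sq_norm_inner_right g
    simp only [hgk, Finset.sum_const, Finset.card_univ, Fintype.card_fin, nsmul_eq_mul,
      Real.norm_eq_abs, sq_abs] at h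
    have h2 : (Module.finrank ℝ E : ℝ) * r ^ 2 = 1 := by
      simp only [r, inv_pow, Real.sq_sqrt hn'.le]
      field_simp
    rw [h2] at h
    exact (pow_eq_one_iff_of_nonneg (norm_nonneg _) two_ne_zero).mp h.symm
  -- The diagonal unit vector g has all coordinates equal to r ≠ 0; the reflection exchanging g and
  -- φ carries u to a basis in which φ has these coordinates.
  let R := (ℝ ∙ (g - φ))ᗮ.reflection
  refine ⟨u.map R, fun k => ?_⟩
  have hR : R g = φ := Submodule.reflection_sub (hg.trans hφ.symm)
  have : ⟪R (u k), R g⟫_ℝ = r := by rw [LinearIsometryEquiv.inner_map_map, hgk]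
  rw [hR] at this
  simpa [this] using hr

/-- On the real span of T the complex inner product is real, hence equals the real one, so a real
orthonormal basis of this span is orthonormal over ℂ and expands T with real coefficients. -/
theorem exists_orthonormal_real_span {T : Set H} (hT : T.Finite)
    (him : ∀ u ∈ T, ∀ v ∈ T, (⟪u, v⟫_ℂ).im = 0) {φ : H} (hφT : φ ∈ T) (hφ : ‖φ‖ = 1) :
    ∃ (n : ℕ) (b : Fin n → H), Orthonormal ℂ b ∧ (∀ u ∈ T, ∀ k, (⟪b k, u⟫_ℂ).im = 0) ∧
      (∀ u ∈ T, ∑ k, ⟪b k, u⟫_ℂ • b k = u) ∧ ∀ k, ⟪b k, φ⟫_ℂ ≠ 0 := by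
  let _ : InnerProductSpace ℝ H := InnerProductSpace.complexToReal
  let Y : Submodule ℝ H := Submodule.span ℝ T
  have : FiniteDimensional ℝ Y := FiniteDimensional.span_of_finite ℝ hT
  have hTY : ∀ u ∈ T, u ∈ Y := fun u hu => Submodule.subset_span hu
  have hY : ∀ u ∈ Y, ∀ v ∈ Y, (⟪u, v⟫_ℂ).im = 0 := by
    intro u hu v hv
    induction hu, hv using Submodule.span_induction₂ with
    | mem_mem u v hu hv => exact him u hu v hv
    | zero_left => simp
    | zero_right => simp
    | add_left a b c _ _ _ h1 h2 => simp [h1, h2]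
    | add_right a b c _ _ _ h1 h2 => simp [h1, h2]
    | smul_left r a b _ _ h => simp [← Complex.coe_smul, h]
    | smul_right r a b _ _ h => simp [← Complex.coe_smul, h]
  obtain ⟨b, hb⟩ := exists_orthonormalBasis_inner_ne_zero (E := Y) (φ := ⟨φ, hTY φ hφT⟩) hφ
  have hin : ∀ u v : Y, ⟪(u : H), (v : H)⟫_ℂ = ((⟪u, v⟫_ℝ : ℝ) : ℂ) := fun u v =>
    Complex.ext rfl (hY u u.2 v v.2)
  refine ⟨_, fun k => (b k : H), ?_, fun u hu k => hY _ (b k).2 _ (hTY u hu), fun u hu => ?_,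
    fun k h => ?_⟩
  · rw [orthonormal_iff_ite]
    intro k l
    rw [hin, orthonormal_iff_ite.mp b.orthonormal k l]
    split_ifs <;> simp
  · have h := congrArg Subtype.val (b.sum_repr' (⟨u, hTY u hu⟩ : Y))
    simp only [AddSubmonoidClass.coe_finsetSum, Submodule.coe_smul] at h
    refine Eq.trans (Finset.sum_congr rfl fun k _ => ?_) h
    rw [← Complex.coe_smul]
    congr 1
    exact hin (b k) ⟨u, hTY u hu⟩
  · refine hb k ?_
    have h1 := hin (b k) ⟨φ, hTY φ hφT⟩
    rw [h] at h1
    exact (Complex.ofReal_eq_zero.mp h1.symm)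

end InnerProduct

/-! ### Projections onto the lines of an orthonormal system -/

section Projections

variable {H : Type*} [NormedAddCommGroup H] [InnerProductSpace ℂ H]

/-- The projections onto the lines spanned by the vectors `b k`, and the projection onto the
orthogonal complement of their span. -/
def lineProjection {n : ℕ} (b : Fin n → H) : Option (Fin n) → H →L[ℂ] H
  | none => 1 - ∑ k, InnerProductSpace.rankOne ℂ (b k) (b k)
  | some k => InnerProductSpace.rankOne ℂ (b k) (b k)

variable {n : ℕ} {b : Fin n → H}

theorem sum_lineProjection : ∑ k, lineProjection b k = 1 := by
  simp [Fintype.sum_option, lineProjection]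

theorem rankOne_mul_rankOne_of_orthonormal (hb : Orthonormal ℂ b) (k l : Fin n) :
    InnerProductSpace.rankOne ℂ (b k) (b k) * InnerProductSpace.rankOne ℂ (b l) (b l)
      = if k = l then InnerProductSpace.rankOne ℂ (b k) (b k) else 0 := by
  ext x
  have h := orthonormal_iff_ite.mp hb k l
  by_cases hkl : k = l
  · subst hkl
    simp [InnerProductSpace.rankOne_apply, hb.1 k]
  · rw [if_neg hkl] at h
    simp [hkl, InnerProductSpace.rankOne_apply, h]

theorem sum_rankOne_mul (hb : Orthonormal ℂ b) (l : Fin n) :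
    (∑ k, InnerProductSpace.rankOne ℂ (b k) (b k)) * InnerProductSpace.rankOne ℂ (b l) (b l)
      = InnerProductSpace.rankOne ℂ (b l) (b l) := by
  rw [Finset.sum_mul]
  simp [rankOne_mul_rankOne_of_orthonormal hb]

theorem mul_sum_rankOne (hb : Orthonormal ℂ b) (l : Fin n) :
    InnerProductSpace.rankOne ℂ (b l) (b l) * (∑ k, InnerProductSpace.rankOne ℂ (b k) (b k))
      = InnerProductSpace.rankOne ℂ (b l) (b l) := by
  rw [Finset.mul_sum]
  simp [rankOne_mul_rankOne_of_orthonormal hb]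

theorem pairwise_lineProjection_mul (hb : Orthonormal ℂ b) :
    Pairwise fun k l => lineProjection b k * lineProjection b l = 0 := by
  rintro (_ | k) (_ | l) hkl
  · exact (hkl rfl).elim
  · simp [lineProjection, sub_mul, sum_rankOne_mul hb]
  · simp [lineProjection, mul_sub, mul_sum_rankOne hb]
  · have : k ≠ l := fun h => hkl (h ▸ rfl)
    simp [lineProjection, rankOne_mul_rankOne_of_orthonormal hb, this]

variable [CompleteSpace H]

theorem isStarProjection_lineProjection (hb : Orthonormal ℂ b) (k : Option (Fin n)) :
    IsStarProjection (lineProjection b k) := by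
  have hs := fun k => InnerProductSpace.isStarProjection_rankOne_self (𝕜 := ℂ) (hb.1 k)
  cases k with
  | none =>
    refine IsStarProjection.one_sub ⟨?_, isSelfAdjoint_sum _ fun k _ => (hs k).isSelfAdjoint⟩
    change _ * _ = _
    rw [Finset.mul_sum]
    exact Finset.sum_congr rfl fun l _ => sum_rankOne_mul hb l
  | some k => exact hs k

end Projections

/-! ### Construction of the simple measurement -/

namespace Measurement

variable {m : ℕ} {H : Type*} [NormedAddCommGroup H] [InnerProductSpace ℂ H] [CompleteSpace H]
  {S : PureStateModel m H} {θ : EuclideanSpace ℝ (Fin m)}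

/-- Vectors whose inner products with each other and with the state vector are real are the
estimation vectors of a simple measurement. -/
theorem exists_isSimple_isIntegral (hθ : θ ∈ S.Θ) {y : Fin m → H}
    (hφy : ∀ i, ⟪S.φ θ, y i⟫_ℂ = 0) {V : Matrix (Fin m) (Fin m) ℝ}
    (hy : ∀ i j, ⟪y i, y j⟫_ℂ = V i j) :
    ∃ E : Measurement m H, E.IsSimple ∧ E.HasLocallyBoundedSecondMoments S θ ∧
      (∀ i, E.IsIntegral (fun x => x i - θ i) (S.φ θ) (y i)) ∧ E.cov S θ = V := by
  have hφ := S.norm_φ θ hθ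
  have hyφ : ∀ i, ⟪y i, S.φ θ⟫_ℂ = 0 := fun i => inner_eq_zero_symm.mp (hφy i)
  obtain ⟨n, b, hb, him, hsum, hne⟩ := exists_orthonormal_real_span
    (T := insert (S.φ θ) (Set.range y)) ((Set.finite_range y).insert _)
    (by
      rintro _ (rfl | ⟨i, rfl⟩) _ (rfl | ⟨j, rfl⟩)
      · simp [inner_self_eq_norm_sq_to_K, ← Complex.ofReal_pow]
      · simp [hφy]
      · simp [hyφ]
      · simp [hy]) (Set.mem_insert _ _) hφ
  have hreal : ∀ u ∈ insert (S.φ θ) (Set.range y), ∀ k, ∃ r : ℝ, ⟪b k, u⟫_ℂ = r :=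
    fun u hu k => ⟨_, Complex.ext rfl (him u hu k)⟩
  have hyT : ∀ i, y i ∈ insert (S.φ θ) (Set.range y) := fun i =>
    Set.mem_insert_of_mem _ ⟨i, rfl⟩
  choose p hp using hreal _ (Set.mem_insert _ _)
  choose q hq using fun i => hreal _ (hyT i)
  have hp0 : ∀ k, p k ≠ 0 := fun k h => hne k (by simp [hp, h])
  -- The quotient is forced by (a k i - θ i) p k = q i k, the coordinate of y i along b k; it is a
  -- real outcome because p and q are real. The complementary projection gets outcome θ, so its
  -- terms vanish.
  let a : Option (Fin n) → EuclideanSpace ℝ (Fin m) := fun k => k.elim θ fun k =>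
    WithLp.toLp 2 fun i => θ i + q i k / p k
  have ha0 : ∀ i, a none i - θ i = 0 := fun i => by simp [a]
  have ha : ∀ k i, a (some k) i - θ i = q i k / p k := fun k i => by simp [a]
  refine ⟨discrete (lineProjection b) a (isStarProjection_lineProjection hb) sum_lineProjection,
    discrete_isSimple (pairwise_lineProjection_mul hb),
    hasLocallyBoundedSecondMoments_discrete hθ, fun i => ?_, ?_⟩
  · have h := isIntegral_discrete (hP := isStarProjection_lineProjection hb)
      (hsum := sum_lineProjection) (a := a) (measurable_coord_sub θ i) (S.φ θ)
    convert h
    rw [Fintype.sum_option, ha0, Complex.ofReal_zero, zero_smul, zero_add]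
    refine (hsum (y i) (hyT i)).symm.trans (Finset.sum_congr rfl fun k _ => ?_)
    rw [ha, lineProjection, InnerProductSpace.rankOne_apply, smul_smul, hq, hp,
      ← Complex.ofReal_mul, div_mul_cancel₀ _ (hp0 k)]
  · ext i j
    rw [cov, Matrix.of_apply, integral_dist_discrete, Fintype.sum_option, ha0, zero_mul, mul_zero,
      zero_add]
    have h1 := hb.inner_sum (fun k => ⟪b k, y i⟫_ℂ) (fun k => ⟪b k, y j⟫_ℂ) Finset.univ
    rw [hsum (y i) (hyT i), hsum (y j) (hyT j), hy] at h1
    apply Complex.ofReal_injective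
    rw [h1, Complex.ofReal_sum]
    refine Finset.sum_congr rfl fun k _ => ?_
    rw [ha, ha, hq, hq, Complex.conj_ofReal, ← Complex.ofReal_mul, lineProjection,
      InnerProductSpace.rankOne_apply, norm_smul, hb.1 k, mul_one, hp, Complex.norm_real,
      Real.norm_eq_abs, sq_abs]
    have := hp0 k
    congr 1
    field_simp

end Measurement

theorem natCast_le_rank_of_infinite {K V : Type*} [DivisionRing K] [AddCommGroup V] [Module K V]
    (h : ¬ FiniteDimensional K V) (n : ℕ) : (n : Cardinal) ≤ Module.rank K V := by
  have : Cardinal.aleph0 ≤ Module.rank K V := by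
    rw [← not_lt]
    exact fun hlt => h (Module.rank_lt_aleph0_iff.mp hlt)
  exact Cardinal.natCast_le_aleph0.trans this

end

/-! ### The main theorem -/

theorem mainTheorem7 {m : ℕ} {H : Type*} [NormedAddCommGroup H] [InnerProductSpace ℂ H]
    [CompleteSpace H]
    (hdim : ((2 * m + 1 : ℕ) : Cardinal) ≤ Module.rank ℂ H ∨ ¬ FiniteDimensional ℂ H)
    (S : PureStateModel m H) (θ : EuclideanSpace ℝ (Fin m)) (hθ : θ ∈ S.Θ)
    (M : Measurement m H) (hfin : M.HasFiniteSecondMoments S θ)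
    (hM : M.HasLocallyUnbiasedEstimationVectors S θ ∨
      (M.IsLocallyUnbiasedAt S θ ∧
        (FiniteDimensional ℂ H ∨ M.HasLocallyBoundedSecondMoments S θ))) :
    ∃ E : Measurement m H, E.IsSimple ∧
      E.HasLocallyBoundedSecondMoments S θ ∧
      E.HasLocallyUnbiasedEstimationVectors S θ ∧
      E.IsLocallyUnbiasedAt S θ ∧
      E.cov S θ = M.cov S θ := by
  have hM' : M.HasLocallyUnbiasedEstimationVectors S θ :=
    hM.elim id fun h => h.1.hasLocallyUnbiasedEstimationVectors hθ hfin h.2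
  choose x hx hφx hlx using hM'
  have hrank : ((m + 1 + m : ℕ) : Cardinal) ≤ Module.rank ℂ H := by
    have h : m + 1 + m = 2 * m + 1 := by omega
    rw [h]
    exact hdim.elim id fun h => natCast_le_rank_of_infinite h _
  -- L contains exactly what (E) tests against: φ and the m lifts, hence dimension at most m + 1.
  -- The other m dimensions hold the corrections in Lᗮ.
  let g : Option (Fin m) → H := fun j => j.elim (S.φ θ) (S.lift θ)
  let L : Submodule ℂ H := Submodule.span ℂ (Set.range g)
  have hgL : ∀ j, g j ∈ L := fun j => Submodule.subset_span ⟨j, rfl⟩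
  have : FiniteDimensional ℂ L := FiniteDimensional.span_of_finite ℂ (Set.finite_range g)
  have hL : Module.finrank ℂ L ≤ m + 1 := (finrank_range_le_card g).trans_eq (by simp)
  obtain ⟨y, hyL, hyV⟩ := exists_gram_eq hrank L hL x (M.cov S θ)
    (fun i j => by simp only [Measurement.cov, Matrix.of_apply, mul_comm])
    (fun c => ⟨_, Measurement.IsIntegral.norm_sum_sq_le hx (Measurement.measurable_coord_sub θ) c,
      integral_norm_sum_mul_sq (fun i => (hx i).1) c⟩)
  have hφy : ∀ i, ⟪S.φ θ, y i⟫_ℂ = 0 := fun i => (hyL _ (hgL none) i).trans (hφx i)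
  obtain ⟨E, hsimple, hbdd, hint, hcov⟩ :=
    Measurement.exists_isSimple_isIntegral hθ hφy hyV
  have hE : E.HasLocallyUnbiasedEstimationVectors S θ := fun i =>
    ⟨y i, hint i, hφy i, fun j =>
      (congrArg RCLike.re (hyL _ (hgL (some j)) i)).trans (hlx i j)⟩
  exact ⟨E, hsimple, hbdd, hE, hE.isLocallyUnbiasedAt hθ hbdd, hcov⟩
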